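/- **Setting.** Let $A$ and $\Theta$ be nonempty finite sets (actions and states), $T\ge 1$, $U:A\times\Theta\to[-1,1]$, and let $D_0$ be a probability distribution with full support on $\Theta^T$. For $\theta=(\theta_1,\dots,\theta_T)\in\Theta^T$ and $t\in\{1,\dots,T\}$ write $$\mathcal M_0(i\mid\theta^{t-1})=\Pr_{D_0}[\theta_t=i\mid\theta_1,\dots,\theta_{t-1}],\qquad \mathcal M_{\rm Polya}(i\mid\theta^{t-1})=\frac{1+\#\{s<t:\theta_s=i\}}{|\Theta|+(t-1)} .$$ For $\mu\in\Delta(\Theta)$, $\mathrm{QBR}(\mu,\eta)\in\Delta(A)$ plays $a$ with probability proportional to $\exp(\frac1\eta\,\mathbb E_{i\sim\mu}U(a,i))$. For mixed actions $\pi_1,\pi_2,\dots$ the regret after $s$ rounds is $\max_{a^*\in A}\frac1s\sum_{r\le s}[U(a^*,\theta_r)-U(\pi_r,\theta_r)]$. Let $\mathrm{Regret}_s$ be this regret for $\pi_r=\mathrm{QBR}(\mathcal M_0(\theta^{r-1}),1/\sqrt T)$, and $\mathrm{Regret}_{\mathrm{Hedge},s}$ the regret for $\pi_r=\mathrm{QBR}(\mathcal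 M_{\rm Polya}(\theta^{r-1}),1/\sqrt T)$. For $\alpha>0$ put $$\rho_s=\tfrac{1}{\sqrt T}\log|A|+\sqrt{8(1+\alpha)(\log T)/s}.$$ The robustification algorithm outputs $\mathcal M_{\rm Polya}(\theta^{t-1})$ if $\mathrm{Regret}_s\ge \mathrm{Regret}_{\mathrm{Hedge},s}+\rho_s$ for some $1\le s\le t-1$, and $\mathcal M_0(\theta^{t-1})$ otherwise. **Transformers.** An MLP is a ReLU network; its width is the largest number of neurons in a hidden layer (0 if it has none) and its depth is the number of hidden layers. An attention layer of embedding dimension $m$ maps $X\in\mathbb R^{T\times m}$ to $X+[Y^1\cdots Y^H]$, where $Y^h=\mathrm{softmax}(XW_Q^h(XW_K^h)^{\mathsf T}+\mathrm{mask})\,XW_V^h$ with the causal mask and real matrices $W_Q^h,W_K^h,W_V^h\in\mathbb R^{m\times d_h}$, $\sum_h d_h=m$ (the columns may be assigned to the heads in any order; the numbers $H$ and $d_h$ may vary between layers). A transformer of depth $L\ge1$ is $g=\phi_L\circ f_L\circ\cdots\circ\phi_1\circ f_1\circ\phi_0$ with attention layers $f_\ell$, MLPs $\phi_1,\dots,\phi_{L-1}:\mathbb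 R^m\to\mathbb R^m$ and $\phi_L:\mathbb R^m\to\mathbb R^{\Theta}$ applied to each row, and an arbitrary embedding $\phi_0$ of the tokens. Its input is the token sequence $\mathrm{BOS},(\theta_1,1),\dots,(\theta_{T-1},T-1)$, and $g(\theta)_t\in\mathbb R^\Theta$ denotes its output at the $t$-th of these $T$ tokens. **Theorem.** There is an absolute constant $C$ such that the following holds for all $A,\Theta,T,D_0,U$ as above. Let $g_0$ be a transformer of depth $L$ and embedding dimension $m$, with at most $H$ heads in each layer and MLPs of width at most $W$ and depth at most $B$, such that $g_0(\theta)_{t}=\mathcal M_0(\theta^{t-1})$ for all $\theta\in\Theta^T$ and $t\le T$. Then for all $\alpha>0$ and $c>0$ there are $\delta\in[0,T^{-c}]$ and a transformer $g'$ of depth $L+4$ and embedding dimension $m'\le m+C(|A|^3+|\Theta|)$ such that * each of the first $L$ attention layers of $g'$ has at most $H+C|A|^2$ heads, and $\phi_1,\dots,\phi_L$ of $g'$ have width at most $W+C(|A|^3+|\Theta|)(1+\lfloor\log_2T\rfloor)$ and depth at most $B+C$; * each of the last four attention layers of $g'$ has at most $C|A|^2$ heads, and $\phi_{L+1},\dots,\phi_{L+4}$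 of $g'$ have width at most $C(|A|^3+|\Theta|)(1+\lfloor\log_2T\rfloor)$ and depth at most $C$; and for all $\theta\in\Theta^T$ and $t\le T$: 1. if there is $1\le s\le t-|A|$ with $\mathrm{Regret}_s\ge\mathrm{Regret}_{\mathrm{Hedge},s}+\rho_s+\delta$, then $g'(\theta)_t=\mathcal M_{\rm Polya}(\theta^{t-1})$; 2. if every $1\le s\le t-|A|$ satisfies $\mathrm{Regret}_s<\mathrm{Regret}_{\mathrm{Hedge},s}+\rho_s-\delta$, then $g'(\theta)_t=\mathcal M_0(\theta^{t-1})=g_0(\theta)_t$. -/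

import Mathlib

open scoped Matrix

noncomputable section

namespace RobustLM

/-! ### Next-token models, quantal responses, regret

States are `Fin N`, actions are `Fin k`, the horizon is `T`.  Rounds are indexed by `t : Fin T`,
so `t` is the (`t + 1`)-st round, and its history consists of the states `θ s` with `s < t`. -/

/-- `Pr_D [θ_t = i | the states before round t are those of θ]`. -/
def nextTokenProb {T N : ℕ} (D : PMF (Fin T → Fin N)) (θ : Fin T → Fin N) (t : Fin T)
    (i : Fin N) : ℝ :=
  (∑ x : Fin T → Fin N with (∀ s, s < t → x s = θ s) ∧ x t = i, (D x).toReal) /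
    (∑ x : Fin T → Fin N with (∀ s, s < t → x s = θ s), (D x).toReal)

/-- The Polya urn model; note that exactly `t` states precede round `t`. -/
def polya {T N : ℕ} (θ : Fin T → Fin N) (t : Fin T) (i : Fin N) : ℝ :=
  (1 + (Finset.card {s : Fin T | s < t ∧ θ s = i} : ℝ)) / ((N : ℝ) + (t : ℕ))

/-- Quantal best response to the distribution `μ` with parameter `η`: action `a` is played with
probability proportional to `exp (U (a, μ) / η)`. -/
def qbr {k N : ℕ} (U : Fin k → Fin N → ℝ) (μ : Fin N → ℝ) (η : ℝ) (a : Fin k) : ℝ :=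
  Real.exp ((∑ i, μ i * U a i) / η) / ∑ b, Real.exp ((∑ i, μ i * U b i) / η)

/-- External regret of the mixed actions `π` over the first `s` rounds (the maximum over fixed
actions of the average gain). -/
def extReg {T k N : ℕ} (U : Fin k → Fin N → ℝ) (π : Fin T → Fin k → ℝ) (θ : Fin T → Fin N)
    (s : ℕ) : ℝ :=
  ⨆ b : Fin k, (1 / (s : ℝ)) *
    ∑ r ∈ Finset.univ.filter (fun r : Fin T => (r : ℕ) < s), (U b (θ r) - ∑ a, π r a * U a (θ r))

/-- `Regret_s`: regret after `s` rounds of quantal responses, with parameter `1 / √T`, to the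
next-token probabilities of `D`. -/
def regret {T k N : ℕ} (U : Fin k → Fin N → ℝ) (D : PMF (Fin T → Fin N)) (θ : Fin T → Fin N)
    (s : ℕ) : ℝ :=
  extReg U (fun r => qbr U (nextTokenProb D θ r) (1 / Real.sqrt T)) θ s

/-- `Regret_{Hedge, s}`: regret after `s` rounds of quantal responses, with parameter `1 / √T`, to
the Polya urn model. -/
def regretHedge {T k N : ℕ} (U : Fin k → Fin N → ℝ) (θ : Fin T → Fin N) (s : ℕ) : ℝ :=
  extReg U (fun r => qbr U (polya θ r) (1 / Real.sqrt T)) θ s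

/-- The margin `log |A| / √T + √(8 (1 + α) log T / s)` of the switching rule. -/
def margin (T k : ℕ) (α : ℝ) (s : ℕ) : ℝ :=
  1 / Real.sqrt T * Real.log k + Real.sqrt (8 * (1 + α) * Real.log T / s)

/-! ### Transformers -/

/-- A multi-layer perceptron from `ℝ^a` to `ℝ^b` with ReLU activations on its hidden layers and an
affine output layer. -/
inductive MLP : ℕ → ℕ → Type
  | affine {a b : ℕ} (W : Matrix (Fin b) (Fin a) ℝ) (v : Fin b → ℝ) : MLP a b
  | hidden {a h b : ℕ} (W : Matrix (Fin h) (Fin a) ℝ) (v : Fin h → ℝ) (rest : MLP h b) : MLP a b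

namespace MLP

/-- The function computed by a multi-layer perceptron. -/
def eval : {a b : ℕ} → MLP a b → (Fin a → ℝ) → Fin b → ℝ
  | _, _, affine W v, x => W *ᵥ x + v
  | _, _, hidden W v rest, x => rest.eval (fun i => max ((W *ᵥ x + v) i) 0)

/-- The largest number of neurons in a hidden layer. -/
def width : {a b : ℕ} → MLP a b → ℕ
  | _, _, affine _ _ => 0
  | _, _, @hidden _ h _ _ _ rest => max h rest.width

/-- The number of hidden layers. -/
def depth : {a b : ℕ} → MLP a b → ℕ
  | _, _, affine _ _ => 0
  | _, _, hidden _ _ rest => rest.depth + 1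

end MLP

/-- Multi-headed attention of embedding dimension `m`.  The columns of `WQ`, `WK`, `WV` are the
columns of the per-head projections, concatenated over the heads: column `j` belongs to the head
`owner j`.  Hence head `h` has as many dimensions as there are `j` with `owner j = h`, and the head
dimensions add up to `m`. -/
structure Attention (m : ℕ) where
  heads : ℕ
  owner : Fin m → Fin heads
  WQ : Matrix (Fin m) (Fin m) ℝ
  WK : Matrix (Fin m) (Fin m) ℝ
  WV : Matrix (Fin m) (Fin m) ℝ

namespace Attention

variable {m T : ℕ} (f : Attention m) (X : Matrix (Fin T) (Fin m) ℝ)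

/-- The inner product of query `t` and key `s` of head `h`. -/
def score (h : Fin f.heads) (t s : Fin T) : ℝ :=
  ∑ j : Fin m with f.owner j = h, (X * f.WQ) t j * (X * f.WK) s j

/-- Concatenated outputs of the heads: causally masked softmax averages of the values. -/
def apply : Matrix (Fin T) (Fin m) ℝ := fun t j =>
  (∑ s ∈ Finset.Iic t, Real.exp (f.score X (f.owner j) t s) * (X * f.WV) s j) /
    ∑ s ∈ Finset.Iic t, Real.exp (f.score X (f.owner j) t s)

/-- An attention layer with its residual connection. -/
def layer : Matrix (Fin T) (Fin m) ℝ := X + f.apply X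

end Attention

/-- A causal transformer with inputs in `(Fin N)^T`, embedding dimension `m` and output in `ℝ^N`
at every position: `φ_L ∘ f_L ∘ ⋯ ∘ φ_1 ∘ f_1 ∘ φ_0`.  Here `bos` and `embed` form the embedding
`φ_0`, `blocks` is the list `(f_1, φ_1), …, (f_{L-1}, φ_{L-1})`, `last` is `f_L` and `out` is
`φ_L`. -/
structure Transformer (T N m : ℕ) where
  /-- embedding of the beginning-of-sequence token -/
  bos : Fin m → ℝ
  /-- embedding of a state together with the position of its token -/
  embed : Fin N → Fin T → Fin m → ℝ
  blocks : List (Attention m × MLP m m)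
  last : Attention m
  out : MLP m N

namespace Transformer

variable {T N m : ℕ} (g : Transformer T N m)

/-- The number of attention layers. -/
def depth : ℕ := g.blocks.length + 1

/-- The embedded input.  Position `0` holds the beginning-of-sequence token and position `p > 0`
holds the state of the round before `p`, together with `p`. -/
def input (θ : Fin T → Fin N) : Matrix (Fin T) (Fin m) ℝ := fun p =>
  if (p : ℕ) = 0 then g.bos
  else g.embed (θ ⟨(p : ℕ) - 1, lt_of_le_of_lt (Nat.sub_le _ _) p.isLt⟩) p

/-- The output sequence; `g.eval θ t` is the output at position `t`, which sees the
beginning-of-sequence token and the states of the rounds before `t`. -/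
def eval (θ : Fin T → Fin N) (t : Fin T) : Fin N → ℝ :=
  g.out.eval (g.last.layer
    (g.blocks.foldl (fun X b => fun p => b.2.eval (b.1.layer X p)) (g.input θ)) t)

end Transformer

end RobustLM

end

open RobustLM

noncomputable section

namespace RobustLM

open Filter Topology

/-! ### Realizing maps on vectors with arbitrary index types -/

/-! The residual stream of the given transformer is widened by `11 + 5k + 4N` registers. While its
layers run on the old coordinates, the registers are carried along; in its last attention layer one
extra head computes the Polya urn exactly, by giving the BOS token weight `N` and value `1 / N`
(`attn_polya`). The old coordinates are then erased, and only the two predictions and token data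
remain.

Four more attention layers evaluate the switching rule. In a difference of regrets the best fixed
action cancels (`extReg_sub_extReg`), so `Regret_s - Regret_{Hedge,s}` is an average of per-round
gains of the urn over the model. Sharp attention copies the expected utilities and the outcome of
the round `k` steps earlier. A softmax over actions is then performed by the softmax of attention,
with the first `k` tokens standing for the actions; the delay by `k` guarantees that all of them are
visible. A ReLU gate picks the utility at the realized outcome (`tendsto_gained`). Uniform attention
averages the gains, which a neuron compares with a threshold stored in the embedding; uniform
attention once more tells whether any comparison so far succeeded.

Sharp attention is exact only as the sharpness `l` tends to infinity. Nevertheless the final output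
is exact: there are finitely many inputs, so one `l` makes all averages accurate to `δ / (2T)`
(`exists_sharpness`); the margin `δ` absorbs this error; the flag is then either exactly zero or
large enough to saturate the output neurons (`readout_collected`); and the two predictions are never
altered by the tail. -/

theorem exists_matrix_mulVec {ι κ : Type} {i o : ℕ} (e : ι ≃ Fin i) (e' : κ ≃ Fin o)
    (L : (ι → ℝ) →ₗ[ℝ] (κ → ℝ)) :
    ∃ A : Matrix (Fin o) (Fin i) ℝ, ∀ x : ι → ℝ, A *ᵥ (x ∘ e.symm) = L x ∘ e'.symm := by
  refine ⟨LinearMap.toMatrix' (LinearMap.funLeft ℝ ℝ e'.symm ∘ₗ L ∘ₗ LinearMap.funLeft ℝ ℝ e),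
    fun x => ?_⟩
  rw [LinearMap.toMatrix'_mulVec]
  have : LinearMap.funLeft ℝ ℝ e (x ∘ e.symm) = x := by
    ext j; simp [LinearMap.funLeft_apply]
  simp only [LinearMap.comp_apply, this]
  rfl

/-- A multi-layer perceptron can be run next to a linear map that factors through `σ → ℝ`, at the
cost of `2 |σ|` neurons in each hidden layer. -/
theorem MLP.exists_parallel {a b : ℕ} (M : MLP a b) :
    ∀ {ι κ σ : Type} [Fintype σ] {i o : ℕ} (e : ι ≃ Fin i) (e' : κ ≃ Fin o)
      (P : (ι → ℝ) →ₗ[ℝ] (Fin a → ℝ)) (S : (Fin b → ℝ) →ₗ[ℝ] (κ → ℝ))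
      (R : (ι → ℝ) →ₗ[ℝ] (σ → ℝ)) (Q : (σ → ℝ) →ₗ[ℝ] (κ → ℝ)),
      ∃ M' : MLP i o, M'.width ≤ M.width + 2 * Fintype.card σ ∧ M'.depth = M.depth ∧
        ∀ x : ι → ℝ, M'.eval (x ∘ e.symm) = (S (M.eval (P x)) + Q (R x)) ∘ e'.symm := by
  induction M with
  | affine W v =>
    intro ι κ σ _ i o e e' P S R Q
    obtain ⟨A, hA⟩ := exists_matrix_mulVec e e' (S ∘ₗ Matrix.mulVecLin W ∘ₗ P + Q ∘ₗ R)
    refine ⟨.affine A (S v ∘ e'.symm), by simp [MLP.width], rfl, fun x => ?_⟩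
    simp only [MLP.eval, hA, map_add]
    ext j
    simp
    ring
  | @hidden a h b W v rest ih =>
    intro ι κ σ _ i o e e' P S R Q
    -- The two copies of `σ` hold the positive and negative parts of the passed vector; their
    -- difference recovers it after the ReLU.
    let d : (Fin h ⊕ (σ ⊕ σ)) ≃ Fin (h + 2 * Fintype.card σ) :=
      Fintype.equivFinOfCardEq (by simp; ring)
    let F : (ι → ℝ) →ₗ[ℝ] (Fin h ⊕ (σ ⊕ σ) → ℝ) := LinearMap.pi (Sum.elim
      (fun j => LinearMap.proj j ∘ₗ Matrix.mulVecLin W ∘ₗ P)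
      (Sum.elim (fun j => LinearMap.proj j ∘ₗ R) (fun j => -(LinearMap.proj j ∘ₗ R))))
    obtain ⟨A, hA⟩ := exists_matrix_mulVec e d F
    obtain ⟨M', hw, hd, hM'⟩ := ih d e' (LinearMap.funLeft ℝ ℝ Sum.inl) S
      (LinearMap.funLeft ℝ ℝ (Sum.inr ∘ Sum.inl) - LinearMap.funLeft ℝ ℝ (Sum.inr ∘ Sum.inr)) Q
    refine ⟨.hidden A (Sum.elim v 0 ∘ d.symm) M', ?_, by simp [MLP.depth, hd], fun x => ?_⟩
    · simp only [MLP.width]; omega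
    · let u : Fin h ⊕ (σ ⊕ σ) → ℝ := fun j => max (F x j + (Sum.elim v 0 : Fin h ⊕ (σ ⊕ σ) → ℝ) j) 0
      have key : (fun j => max ((A *ᵥ (x ∘ e.symm) + Sum.elim v 0 ∘ d.symm) j) 0) =
          u ∘ d.symm := by
        rw [hA]; rfl
      have h1 : LinearMap.funLeft ℝ ℝ Sum.inl u = fun j => max ((W *ᵥ P x + v) j) 0 := rfl
      have h2 : (LinearMap.funLeft ℝ ℝ (Sum.inr ∘ Sum.inl) -
          LinearMap.funLeft ℝ ℝ (Sum.inr ∘ Sum.inr) :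
            (Fin h ⊕ (σ ⊕ σ) → ℝ) →ₗ[ℝ] (σ → ℝ)) u = R x := by
        ext j
        change max (R x j + 0) 0 - max (-(R x j) + 0) 0 = R x j
        rcases le_total 0 (R x j) with h | h
        · rw [max_eq_left (by linarith), max_eq_right (by linarith)]; ring
        · rw [max_eq_right (by linarith), max_eq_left (by linarith)]; ring
      simp only [MLP.eval]
      rw [key, hM', h1, h2]

/-- One hidden layer with neurons indexed by `ν`, next to a linear map. -/
theorem MLP.exists_hidden {ι κ σ ν : Type} [Fintype σ] [Fintype ν] {i o : ℕ} (e : ι ≃ Fin i)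
    (e' : κ ≃ Fin o) (w : ν → Module.Dual ℝ (ι → ℝ)) (c : ν → ℝ)
    (S : (ν → ℝ) →ₗ[ℝ] (κ → ℝ)) (R : (ι → ℝ) →ₗ[ℝ] (σ → ℝ)) (Q : (σ → ℝ) →ₗ[ℝ] (κ → ℝ)) :
    ∃ M : MLP i o, M.width ≤ Fintype.card ν + 2 * Fintype.card σ ∧ M.depth = 1 ∧
      ∀ x : ι → ℝ,
        M.eval (x ∘ e.symm) = (S (fun n => max (w n x + c n) 0) + Q (R x)) ∘ e'.symm := by
  let d := Fintype.equivFin ν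
  obtain ⟨M, hw, hd, hM⟩ := (MLP.hidden 1 (c ∘ d.symm) (.affine 1 0)).exists_parallel e e'
    (LinearMap.funLeft ℝ ℝ d.symm ∘ₗ LinearMap.pi w) (S ∘ₗ LinearMap.funLeft ℝ ℝ d) R Q
  refine ⟨M, by simpa [MLP.width] using hw, by simpa [MLP.depth] using hd, fun x => ?_⟩
  rw [hM]
  congr 2
  simp only [LinearMap.comp_apply]
  congr 1
  ext n
  simp [MLP.eval, LinearMap.funLeft_apply]

/-- The matrix whose rows are the vectors `X t`, reindexed along `e`. -/
def encode {T m : ℕ} {ι : Type} (e : ι ≃ Fin m) (X : Fin T → ι → ℝ) : Matrix (Fin T) (Fin m) ℝ :=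
  fun t j => X t (e.symm j)

/-! ### Attention layers on an arbitrary index type -/

section attn

variable {T : ℕ} {ι η : Type} [Fintype ι] [DecidableEq η]

/-- Query-key inner products, with the columns of the projections given as linear forms. -/
def scoreOf (owner : ι → η) (q k : ι → Module.Dual ℝ (ι → ℝ)) (X : Fin T → ι → ℝ) (h : η)
    (t s : Fin T) : ℝ :=
  ∑ j with owner j = h, q j (X t) * k j (X s)

/-- The attention layer with the given linear forms as columns of its projections. -/
def attn (owner : ι → η) (q k v : ι → Module.Dual ℝ (ι → ℝ)) (X : Fin T → ι → ℝ) :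
    Fin T → ι → ℝ := fun t j =>
  X t j + (∑ s ∈ Finset.Iic t, Real.exp (scoreOf owner q k X (owner j) t s) * v j (X s)) /
    ∑ s ∈ Finset.Iic t, Real.exp (scoreOf owner q k X (owner j) t s)

/-- A linear form is determined by its values on the standard basis, which serve as matrix entries.
This allows layers to be designed on named coordinates. -/
theorem exists_attention [DecidableEq ι] {m h : ℕ} (e : ι ≃ Fin m) (d : η ≃ Fin h) (owner : ι → η)
    (q k v : ι → Module.Dual ℝ (ι → ℝ)) :
    ∃ f : Attention m, f.heads = h ∧ ∀ (T : ℕ) (X : Fin T → ι → ℝ),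
      f.layer (encode e X) = encode e (attn owner q k v X) := by
  let mat (q : ι → Module.Dual ℝ (ι → ℝ)) : Matrix (Fin m) (Fin m) ℝ :=
    fun i j => q (e.symm j) (Pi.single (e.symm i) 1)
  have hmat : ∀ (q : ι → Module.Dual ℝ (ι → ℝ)) {T : ℕ} (X : Fin T → ι → ℝ) (t : Fin T) (j : Fin m),
      (encode e X * mat q) t j = q (e.symm j) (X t) := by
    intro q T X t j
    rw [Matrix.mul_apply, LinearMap.pi_apply_eq_sum_univ (q (e.symm j)) (X t), ← e.symm.sum_comp]
    refine Finset.sum_congr rfl fun i _ => ?_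
    simp only [encode, smul_eq_mul, mat]
    congr 2
    ext x
    simp [Pi.single_apply, eq_comm]
  let f : Attention m := ⟨h, d ∘ owner ∘ e.symm, mat q, mat k, mat v⟩
  have hs : ∀ {T : ℕ} (X : Fin T → ι → ℝ) (j : Fin m) (t s : Fin T),
      f.score (encode e X) (f.owner j) t s = scoreOf owner q k X (owner (e.symm j)) t s := by
    intro T X j t s
    have h1 : ∀ i, f.owner i = f.owner j ↔ owner (e.symm i) = owner (e.symm j) :=
      fun i => d.injective.eq_iff
    simp only [Attention.score, scoreOf, Finset.sum_filter, h1, f, hmat]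
    exact e.symm.sum_comp fun i =>
      if owner i = owner (e.symm j) then q i (X t) * k i (X s) else 0
  have hv : ∀ {T : ℕ} (X : Fin T → ι → ℝ) (t : Fin T) (j : Fin m),
      (encode e X * f.WV) t j = v (e.symm j) (X t) := fun X t j => hmat v X t j
  refine ⟨f, rfl, fun T X => ?_⟩
  ext t j
  simp only [Attention.layer, Matrix.add_apply, Attention.apply, hs, hv]
  rfl

theorem attn_of_value_eq_zero {owner : ι → η} {q k v : ι → Module.Dual ℝ (ι → ℝ)} {j : ι}
    (hj : v j = 0) (X : Fin T → ι → ℝ) (t : Fin T) : attn owner q k v X t j = X t j := by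
  simp [attn, hj]

/-- With zero queries all scores vanish, so attention is the uniform average over the visible
positions. -/
theorem attn_of_query_eq_zero {owner : ι → η} {k v : ι → Module.Dual ℝ (ι → ℝ)} {j : ι}
    (X : Fin T → ι → ℝ) (t : Fin T) :
    attn owner 0 k v X t j = X t j + (∑ s ∈ Finset.Iic t, v j (X s)) / ((t : ℕ) + 1) := by
  simp [attn, scoreOf]

/-- Limits of attention layers; the scores need to converge up to a common shift only. -/
theorem tendsto_attn {owner : ι → η} {q k v : ℝ → ι → Module.Dual ℝ (ι → ℝ)}
    {X : ℝ → Fin T → ι → ℝ} {t : Fin T} {j : ι} {x : ℝ} (c : ℝ → ℝ) (w y : Fin T → ℝ)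
    (hX : Tendsto (fun l => X l t j) atTop (𝓝 x))
    (hw : ∀ s ≤ t, Tendsto (fun l => Real.exp (scoreOf owner (q l) (k l) (X l) (owner j) t s - c l))
      atTop (𝓝 (w s)))
    (hy : ∀ s ≤ t, Tendsto (fun l => v l j (X l s)) atTop (𝓝 (y s)))
    (h0 : ∑ s ∈ Finset.Iic t, w s ≠ 0) :
    Tendsto (fun l => attn owner (q l) (k l) (v l) (X l) t j) atTop
      (𝓝 (x + (∑ s ∈ Finset.Iic t, w s * y s) / ∑ s ∈ Finset.Iic t, w s)) := by
  have : ∀ l, attn owner (q l) (k l) (v l) (X l) t j = X l t j +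
      (∑ s ∈ Finset.Iic t, Real.exp (scoreOf owner (q l) (k l) (X l) (owner j) t s - c l) *
        v l j (X l s)) /
      ∑ s ∈ Finset.Iic t, Real.exp (scoreOf owner (q l) (k l) (X l) (owner j) t s - c l) := by
    intro l
    simp only [attn, Real.exp_sub, div_mul_eq_mul_div, ← Finset.sum_div]
    rw [div_div_div_cancel_right₀ (Real.exp_ne_zero _)]
  simp only [this]
  refine hX.add (Tendsto.div ?_ ?_ h0)
  · exact tendsto_finsetSum _ fun s hs =>
      (hw s (Finset.mem_Iic.1 hs)).mul (hy s (Finset.mem_Iic.1 hs))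
  · exact tendsto_finsetSum _ fun s hs => hw s (Finset.mem_Iic.1 hs)

end attn

/-! ### Running a transformer next to additional coordinates -/

/-- A block: an attention layer, followed by a multi-layer perceptron on each row. -/
def blockStep {T m : ℕ} (X : Matrix (Fin T) (Fin m) ℝ) (b : Attention m × MLP m m) :
    Matrix (Fin T) (Fin m) ℝ := fun p => b.2.eval (b.1.layer X p)

theorem Transformer.eval_eq {T N m : ℕ} (g : Transformer T N m) (θ : Fin T → Fin N) (t : Fin T) :
    g.eval θ t = g.out.eval (g.last.layer (g.blocks.foldl blockStep (g.input θ)) t) := rfl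

section extend

variable {m : ℕ} {E : Type} [Fintype E]

/-- Side-by-side states of a transformer and of additional coordinates. -/
def sideBySide {T : ℕ} (X : Matrix (Fin T) (Fin m) ℝ) (Y : Fin T → E → ℝ) :
    Fin T → Fin m ⊕ E → ℝ := fun t => Sum.elim (X t) (Y t)

/-- An attention layer together with more heads acting on additional coordinates. -/
theorem exists_extend_attention [DecidableEq E] {m' h : ℕ} {η : Type} [DecidableEq η]
    (e : Fin m ⊕ E ≃ Fin m') (d : η ≃ Fin h) (f : Attention m)
    (own : E → η) (q k v : E → Module.Dual ℝ (E → ℝ)) :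
    ∃ f' : Attention m', f'.heads = f.heads + h ∧
      ∀ (T : ℕ) (X : Matrix (Fin T) (Fin m) ℝ) (Y : Fin T → E → ℝ),
        f'.layer (encode e (sideBySide X Y)) =
          encode e (sideBySide (f.layer X) (attn own q k v Y)) := by
  let P : (Fin m ⊕ E → ℝ) →ₗ[ℝ] (Fin m → ℝ) := LinearMap.funLeft ℝ ℝ Sum.inl
  let R : (Fin m ⊕ E → ℝ) →ₗ[ℝ] (E → ℝ) := LinearMap.funLeft ℝ ℝ Sum.inr
  let col (W : Matrix (Fin m) (Fin m) ℝ) (q : E → Module.Dual ℝ (E → ℝ)) :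
      Fin m ⊕ E → Module.Dual ℝ (Fin m ⊕ E → ℝ) :=
    Sum.elim (fun j => LinearMap.proj j ∘ₗ Matrix.vecMulLinear W ∘ₗ P) (fun j => q j ∘ₗ R)
  let owner : Fin m ⊕ E → Fin f.heads ⊕ η :=
    Sum.elim (fun j => Sum.inl (f.owner j)) (fun j => Sum.inr (own j))
  obtain ⟨f', hh, hf'⟩ := exists_attention e
    ((Equiv.sumCongr (Equiv.refl _) d).trans finSumFinEquiv) owner (col f.WQ q) (col f.WK k)
    (col f.WV v)
  refine ⟨f', hh, fun T X Y => ?_⟩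
  have hl : ∀ (W : Matrix (Fin m) (Fin m) ℝ) (q : E → Module.Dual ℝ (E → ℝ)) (j : Fin m)
      (t : Fin T), col W q (Sum.inl j) (sideBySide X Y t) = (X * W) t j := fun _ _ _ _ => rfl
  have hr : ∀ (W : Matrix (Fin m) (Fin m) ℝ) (q : E → Module.Dual ℝ (E → ℝ)) (j : E)
      (t : Fin T), col W q (Sum.inr j) (sideBySide X Y t) = q j (Y t) := fun _ _ _ _ => rfl
  have hsl : ∀ (h : Fin f.heads) (t s : Fin T), scoreOf owner (col f.WQ q) (col f.WK k)
      (sideBySide X Y) (Sum.inl h) t s = f.score X h t s := by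
    intro h t s
    simp only [scoreOf, Finset.sum_filter, Fintype.sum_sum_type, hl, Attention.score]
    simp [owner]
  have hsr : ∀ (h : η) (t s : Fin T), scoreOf owner (col f.WQ q) (col f.WK k)
      (sideBySide X Y) (Sum.inr h) t s = scoreOf own q k Y h t s := by
    intro h t s
    simp only [scoreOf, Finset.sum_filter, Fintype.sum_sum_type, hr]
    simp [owner]
  rw [hf']
  congr 1
  ext t j
  rcases j with j | j
  · simp only [attn, hl]
    change _ + (∑ s ∈ _, Real.exp (scoreOf owner _ _ _ (Sum.inl (f.owner j)) t s) * _) /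
      (∑ s ∈ _, Real.exp (scoreOf owner _ _ _ (Sum.inl (f.owner j)) t s)) = _
    simp only [hsl]
    rfl
  · simp only [attn, hr]
    change _ + (∑ s ∈ _, Real.exp (scoreOf owner _ _ _ (Sum.inr (own j)) t s) * _) /
      (∑ s ∈ _, Real.exp (scoreOf owner _ _ _ (Sum.inr (own j)) t s)) = _
    simp only [hsr]
    rfl

/-- A stack of blocks can be run while additional coordinates are passed on unchanged. -/
theorem exists_extend_blocks [DecidableEq E] {m' H W B : ℕ} (e : Fin m ⊕ E ≃ Fin m')
    (bs : List (Attention m × MLP m m))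
    (hb : ∀ b ∈ bs, b.1.heads ≤ H ∧ b.2.width ≤ W ∧ b.2.depth ≤ B) :
    ∃ bs' : List (Attention m' × MLP m' m'), bs'.length = bs.length ∧
      (∀ b ∈ bs', b.1.heads ≤ H + 1 ∧ b.2.width ≤ W + 2 * Fintype.card E ∧ b.2.depth ≤ B) ∧
      ∀ (T : ℕ) (X : Matrix (Fin T) (Fin m) ℝ) (Y : Fin T → E → ℝ),
        bs'.foldl blockStep (encode e (sideBySide X Y)) =
          encode e (sideBySide (bs.foldl blockStep X) Y) := by
  induction bs with
  | nil => exact ⟨[], rfl, by simp, fun _ _ _ => rfl⟩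
  | cons b bs ih =>
    obtain ⟨bs', hl, hbs, hf⟩ := ih fun b hb' => hb b (List.mem_cons_of_mem _ hb')
    obtain ⟨h1, h2, h3⟩ := hb b List.mem_cons_self
    -- Every column needs an owner; one idle head with zero values owns all new columns, hence `H +
    -- 1`.
    obtain ⟨f', hh, hf'⟩ := exists_extend_attention e finOneEquiv.symm b.1 (fun _ => ()) 0 0 0
    obtain ⟨M, hw, hd, hM⟩ := b.2.exists_parallel e e (LinearMap.funLeft ℝ ℝ Sum.inl)
      (LinearMap.pi (Sum.elim LinearMap.proj 0))
      (LinearMap.funLeft ℝ ℝ Sum.inr) (LinearMap.pi (Sum.elim 0 LinearMap.proj))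
    refine ⟨(f', M) :: bs', by simp [hl], ?_, fun T X Y => ?_⟩
    · intro b' hb'
      rcases List.mem_cons.1 hb' with rfl | hb'
      · exact ⟨by simp only; omega, by simp only; omega, by simp only; omega⟩
      · exact hbs b' hb'
    · rw [List.foldl_cons, List.foldl_cons, ← hf]
      congr 1
      have h0 : attn (fun _ : E => ()) 0 0 0 Y = Y := by
        ext t j; exact attn_of_value_eq_zero rfl Y t
      ext p j
      rw [blockStep, hf', h0]
      refine (congrFun (hM (sideBySide (b.1.layer X) Y p)) j).trans ?_
      simp only [Function.comp, encode]
      rcases e.symm j with i | i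
      · simp [sideBySide]; rfl
      · simp [sideBySide]

/-- An attention layer acting on the additional coordinates only. -/
theorem exists_tail_attention [DecidableEq E] {m' h : ℕ} {η : Type} [DecidableEq η]
    (e : Fin m ⊕ E ≃ Fin m') (d : η ≃ Fin h) (own : E → η) (q k v : E → Module.Dual ℝ (E → ℝ)) :
    ∃ f' : Attention m', f'.heads = 1 + h ∧ ∀ (T : ℕ) (Y : Fin T → E → ℝ),
      f'.layer (encode e (sideBySide 0 Y)) = encode e (sideBySide 0 (attn own q k v Y)) := by
  obtain ⟨f', hh, hf'⟩ := exists_extend_attention e d ⟨1, fun _ => 0, 0, 0, 0⟩ own q k v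
  refine ⟨f', hh, fun T Y => ?_⟩
  rw [hf']
  congr 2
  ext t j
  simp [Attention.layer, Attention.apply]

/-- A hidden layer acting on the additional coordinates only; its output is added to them. -/
theorem exists_tail_mlp {m' : ℕ} {ν : Type} [Fintype ν] (e : Fin m ⊕ E ≃ Fin m')
    (w : ν → Module.Dual ℝ (E → ℝ)) (c : ν → ℝ) (S : (ν → ℝ) →ₗ[ℝ] (E → ℝ)) :
    ∃ M : MLP m' m', M.width ≤ Fintype.card ν + 2 * Fintype.card E ∧ M.depth = 1 ∧
      ∀ (T : ℕ) (Y : Fin T → E → ℝ) (p : Fin T), M.eval (encode e (sideBySide 0 Y) p) =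
        encode e (sideBySide 0 fun p => Y p + S (fun n => max (w n (Y p) + c n) 0)) p := by
  obtain ⟨M, hw, hd, hM⟩ := MLP.exists_hidden e e
    (fun n => w n ∘ₗ LinearMap.funLeft ℝ ℝ Sum.inr) c
    (LinearMap.pi (Sum.elim 0 LinearMap.proj) ∘ₗ S)
    (LinearMap.funLeft ℝ ℝ Sum.inr) (LinearMap.pi (Sum.elim 0 LinearMap.proj))
  refine ⟨M, hw, hd, fun T Y p => (hM (sideBySide 0 Y p)).trans ?_⟩
  have : LinearMap.funLeft ℝ ℝ Sum.inr (sideBySide (m := m) 0 Y p) = Y p := rfl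
  ext j
  simp only [Function.comp, encode, LinearMap.comp_apply, this]
  rcases e.symm j with i | i
  · simp [sideBySide]
  · simp [sideBySide, add_comm]

end extend

/-! ### The additional coordinates -/

/-- Scalar registers. -/
inductive Reg
  | const | bos | pos | posSq | src | nxt | thr | gain | avg | flag | any
  deriving DecidableEq

/-- Registers with one entry for each action. -/
inductive ActReg
  | first | util | utilPolya | play | playPolya
  deriving DecidableEq

/-- Registers with one entry for each state. -/
inductive StReg
  | state | polya | model | outcome
  deriving DecidableEq

/-- The additional coordinates for `k` actions and `N` states. -/
abbrev Slot (k N : ℕ) : Type := Reg ⊕ (ActReg × Fin k ⊕ StReg × Fin N)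

instance : Fintype Reg :=
  ⟨{.const, .bos, .pos, .posSq, .src, .nxt, .thr, .gain, .avg, .flag, .any}, by
    rintro ⟨⟩ <;> simp⟩

theorem Reg.sum_univ (f : Reg → ℝ) : ∑ x, f x = f .const + f .bos + f .pos + f .posSq + f .src +
    f .nxt + f .thr + f .gain + f .avg + f .flag + f .any := by
  have : (Finset.univ : Finset Reg) =
      {.const, .bos, .pos, .posSq, .src, .nxt, .thr, .gain, .avg, .flag, .any} := rfl
  simp [this, add_assoc]

instance : Fintype ActReg :=
  ⟨{.first, .util, .utilPolya, .play, .playPolya}, by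
    rintro ⟨⟩ <;> simp⟩

theorem ActReg.sum_univ (f : ActReg → ℝ) : ∑ x, f x =
    f .first + f .util + f .utilPolya + f .play + f .playPolya := by
  have : (Finset.univ : Finset ActReg) = {.first, .util, .utilPolya, .play, .playPolya} := rfl
  simp [this, add_assoc]

instance : Fintype StReg :=
  ⟨{.state, .polya, .model, .outcome}, by
    rintro ⟨⟩ <;> simp⟩

theorem StReg.sum_univ (f : StReg → ℝ) : ∑ x, f x =
    f .state + f .polya + f .model + f .outcome := by
  have : (Finset.univ : Finset StReg) = {.state, .polya, .model, .outcome} := rfl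
  simp [this, add_assoc]

theorem card_slot (k N : ℕ) : Fintype.card (Slot k N) = 11 + (5 * k + 4 * N) := by
  have h1 : Fintype.card Reg = 11 := rfl
  have h2 : Fintype.card ActReg = 5 := rfl
  have h3 : Fintype.card StReg = 4 := rfl
  simp [h1, h2, h3]

section slots

variable {k N T : ℕ}

/-- A scalar register. -/
abbrev rg (x : Reg) : Slot k N := Sum.inl x
/-- An entry of an action register. -/
abbrev ac (x : ActReg) (a : Fin k) : Slot k N := Sum.inr (Sum.inl (x, a))
/-- An entry of a state register. -/
abbrev st (x : StReg) (i : Fin N) : Slot k N := Sum.inr (Sum.inr (x, i))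

/-- The linear form that reads off a coordinate. -/
abbrev rd (j : Slot k N) : Module.Dual ℝ (Slot k N → ℝ) := LinearMap.proj j

theorem Slot.sum_univ (f : Slot k N → ℝ) : ∑ j, f j =
    ∑ x, f (rg x) + (∑ x, ∑ a, f (ac x a) + ∑ x, ∑ i, f (st x i)) := by
  simp [Fintype.sum_sum_type, Fintype.sum_prod_type]

/-- The additional coordinates of the token at position `p`: `τ p` is a threshold, `o` is the
state that the token holds, and `ν`, `μ` are next-token probabilities. -/
def tokenSlots (τ : ℕ → ℝ) (p : ℕ) (o : Option (Fin N)) (ν μ : Fin N → ℝ) : Slot k N → ℝ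
  | .inl .const => 1
  | .inl .bos => if p = 0 then 1 else 0
  | .inl .pos => p
  | .inl .posSq => (p : ℝ) ^ 2
  | .inl .src => (p - k : ℕ)
  | .inl .nxt => (p + 1 - k : ℕ)
  | .inl .thr => τ p
  | .inl _ => 0
  | .inr (.inl (.first, a)) => if p = a then 1 else 0
  | .inr (.inl _) => 0
  | .inr (.inr (.state, i)) => if o = some i then 1 else 0
  | .inr (.inr (.polya, i)) => ν i
  | .inr (.inr (.model, i)) => μ i
  | .inr (.inr (.outcome, _)) => 0

/-- The state that the token at position `p` holds. -/
def heldState (θ : Fin T → Fin N) (p : Fin T) : Option (Fin N) :=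
  if (p : ℕ) = 0 then none else some (θ ⟨(p : ℕ) - 1, lt_of_le_of_lt (Nat.sub_le _ _) p.isLt⟩)

/-! ### The Polya urn as an attention head -/

/-- Converts sums over positions into sums over rounds when position `s` carries data of round `s -
d`: `d = 1` for the states held by tokens, `d = k` for the delayed gains. -/
theorem sum_Iic_shift (d : ℕ) (t : Fin T) (F G : Fin T → ℝ) (h0 : ∀ s : Fin T, (s : ℕ) < d → F s = 0)
    (h1 : ∀ (r s : Fin T), (s : ℕ) = r + d → F s = G r) :
    ∑ s ∈ Finset.Iic t, F s = ∑ r ∈ Finset.univ.filter (fun r : Fin T => (r : ℕ) + d ≤ t), G r := by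
  have ht := t.isLt
  obtain ⟨f, hf⟩ : ∃ f : Fin T → Fin T, ∀ r : Fin T, (r : ℕ) + d ≤ t → (f r : ℕ) = r + d :=
    ⟨fun r => if h : (r : ℕ) + d < T then ⟨(r : ℕ) + d, h⟩ else r, fun r hr => by
      simp [show (r : ℕ) + d < T by omega]⟩
  symm
  refine Finset.sum_of_injOn f ?_ ?_ ?_ ?_
  · intro r hr r' hr' h
    simp only [Finset.coe_filter, Finset.mem_univ, true_and, Set.mem_ofPred_eq] at hr hr'
    have := hf r hr
    rw [h, hf r' hr'] at this
    exact Fin.ext (by omega)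
  · intro r hr
    simp only [Finset.coe_filter, Finset.mem_univ, true_and, Set.mem_ofPred_eq] at hr
    simpa [Fin.le_def, hf r hr] using hr
  · intro s hs hs'
    refine h0 s (not_le.1 fun hd => hs' ?_)
    have h2 := s.isLt
    have h3 : (s : ℕ) ≤ t := Fin.le_def.1 (Finset.mem_Iic.1 hs)
    refine ⟨⟨(s : ℕ) - d, by omega⟩, by simp; omega, Fin.ext ?_⟩
    rw [hf _ (by simp only; omega)]
    simp only; omega
  · intro r hr
    simp only [Finset.mem_filter, Finset.mem_univ, true_and] at hr
    exact (h1 r _ (hf r hr)).symm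

/-- Queries of the Polya head. -/
def polyaQ : Slot k N → Module.Dual ℝ (Slot k N → ℝ)
  | .inl .const => rd (rg .const)
  | _ => 0

/-- Keys of the Polya head. -/
def polyaK : Slot k N → Module.Dual ℝ (Slot k N → ℝ)
  | .inl .const => Real.log N • rd (rg .bos)
  | _ => 0

/-- Values of the Polya head. -/
def polyaV : Slot k N → Module.Dual ℝ (Slot k N → ℝ)
  | .inr (.inr (.polya, i)) => rd (st .state i) + (1 / (N : ℝ)) • rd (rg .bos)
  | _ => 0

/-- The BOS key `log N` gives weight `N` to BOS and weight `1` to each of the `t` later tokens, so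
the denominator is `N + t`. The value `1 / N` at BOS supplies the `1` in the numerator, and the
one-hot states supply the counts. -/
theorem attn_polya (hN : 0 < N) (τ : ℕ → ℝ) (θ : Fin T → Fin N) :
    attn (fun _ => ()) polyaQ polyaK polyaV
      (fun p : Fin T => tokenSlots (k := k) τ p (heldState θ p) 0 0) =
    fun p : Fin T => tokenSlots τ p (heldState θ p) (polya θ p) 0 := by
  have hN' : (N : ℝ) ≠ 0 := by positivity
  ext t j
  by_cases hj : ∃ i, j = st .polya i
  · obtain ⟨i, rfl⟩ := hj
    have hs : ∀ s : Fin T, Real.exp (scoreOf (fun _ => ()) polyaQ polyaK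
        (fun p : Fin T => tokenSlots (k := k) τ p (heldState θ p) 0 0) () t s) =
        1 + if (s : ℕ) = 0 then (N : ℝ) - 1 else 0 := by
      intro s
      have : scoreOf (fun _ => ()) polyaQ polyaK
        (fun p : Fin T => tokenSlots (k := k) τ p (heldState θ p) 0 0) () t s =
        Real.log N * if (s : ℕ) = 0 then 1 else 0 := by
        simp [scoreOf, Fintype.sum_sum_type, Reg.sum_univ, polyaQ, polyaK, tokenSlots]
      rw [this]
      split_ifs
      · rw [mul_one, Real.exp_log (by positivity)]; ring
      · simp
    have hT : 0 < T := by have := t.isLt; omega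
    have hsum : ∀ c : ℝ, (∑ s ∈ Finset.Iic t, if (s : ℕ) = 0 then c else 0) = c := by
      intro c
      rw [Finset.sum_eq_single (⟨0, hT⟩ : Fin T)]
      · simp
      · intro s _ hs
        rw [if_neg fun h => hs (Fin.ext h)]
      · intro h
        exact absurd (Finset.mem_Iic.2 (Fin.le_def.2 (Nat.zero_le _))) h
    have hnum : ∀ s : Fin T, (1 + if (s : ℕ) = 0 then (N : ℝ) - 1 else 0) *
        polyaV (st .polya i) (tokenSlots (k := k) τ s (heldState θ s) 0 0) =
        (if (s : ℕ) = 0 then 1 else 0) + if heldState θ s = some i then 1 else 0 := by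
      intro s
      by_cases h : (s : ℕ) = 0
      · simp [polyaV, tokenSlots, h, heldState, hN']
      · simp [polyaV, tokenSlots, h]
    simp only [attn, hs, hnum, Finset.sum_add_distrib, hsum]
    rw [sum_Iic_shift 1 t _ (fun r => if θ r = i then 1 else 0)]
    · simp only [Finset.sum_const, Fin.card_Iic, tokenSlots, polya, nsmul_eq_mul, mul_one,
        Pi.zero_apply, zero_add]
      congr 1
      · rw [← Finset.sum_filter, Finset.filter_filter]
        simp
      · push_cast; ring
    · intro s hs
      simp [heldState, show (s : ℕ) = 0 by omega]
    · intro r s hs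
      simp [heldState, hs]
  · rw [attn_of_value_eq_zero]
    · rcases j with (_ | _ | _) | (⟨_ | _, _⟩ | ⟨_ | _, _⟩) <;> first | rfl | simp at hj
    · rcases j with (_ | _ | _) | (⟨_ | _, _⟩ | ⟨_ | _, _⟩) <;> first | rfl | simp at hj

end slots

/-! ### The four final layers, and their limits for sharp attention. -/

section tail

variable {k N T : ℕ}

/-! ### Attending to one earlier position -/

/-- The exponent is `-l (b - a)²`. Only `2 l a b - l b²` has to be realized as a score; the
remaining term does not depend on the key position and cancels in the softmax. -/
theorem tendsto_exp_neg_sq (a b : ℕ) :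
    Tendsto (fun l : ℝ => Real.exp (2 * l * a * b - l * b ^ 2 - l * a ^ 2)) atTop
      (𝓝 (if b = a then 1 else 0)) := by
  have h : ∀ l : ℝ, 2 * l * a * b - l * b ^ 2 - l * a ^ 2 = -(l * ((b : ℝ) - a) ^ 2) :=
    fun l => by ring
  simp only [h]
  split_ifs with hab
  · simp [hab]
  · have : ((b : ℝ) - a) ≠ 0 := sub_ne_zero.2 (by exact_mod_cast hab)
    exact Real.tendsto_exp_neg_atTop_nhds_zero.comp (tendsto_id.atTop_mul_const (by positivity))

theorem tendsto_attn_sharp {ι η : Type} [Fintype ι] [DecidableEq η] {owner : ι → η}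
    {q v : ι → Module.Dual ℝ (ι → ℝ)} {K : ℝ → ι → Module.Dual ℝ (ι → ℝ)} {X : Fin T → ι → ℝ}
    {t : Fin T} {j : ι} (n : Fin T) (hn : n ≤ t) (hX : X t j = 0)
    (hs : ∀ l, ∀ s ≤ t, scoreOf owner q (K l) X (owner j) t s =
      2 * l * (n : ℕ) * (s : ℕ) - l * (s : ℕ) ^ 2) :
    Tendsto (fun l => attn owner q (K l) v X t j) atTop (𝓝 (v j (X n))) := by
  have hsum : ∀ y : Fin T → ℝ,
      ∑ s ∈ Finset.Iic t, (if (s : ℕ) = n then 1 else 0) * y s = y n := by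
    intro y
    rw [Finset.sum_eq_single n]
    · simp
    · intro s _ hsn
      simp [Fin.val_inj, hsn]
    · intro h
      exact absurd (Finset.mem_Iic.2 hn) h
  have h1 := hsum fun _ => 1
  simp only [mul_one] at h1
  have := tendsto_attn (q := fun _ => q) (k := K) (v := fun _ => v) (X := fun _ => X)
    (owner := owner) (t := t) (j := j) (x := 0) (fun l => l * (n : ℕ) ^ 2)
    (fun s => if (s : ℕ) = n then 1 else 0) (fun s => v j (X s)) (by simp [hX])
    (fun s hst => by
      simp only [hs _ s hst]
      exact tendsto_exp_neg_sq n s)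
    (fun s _ => tendsto_const_nhds) (by rw [h1]; exact one_ne_zero)
  simpa only [hsum, h1, zero_add, div_one] using this

/-! ### Copying the expected utilities and the outcome of an earlier round -/

/-- Owners of the columns of the copying layer. -/
def shiftOwner : Slot k N → Bool
  | .inl .nxt => true
  | .inl .thr => true
  | .inr (.inr (.outcome, _)) => true
  | _ => false

/-- Queries of the copying layer. -/
def shiftQ : Slot k N → Module.Dual ℝ (Slot k N → ℝ)
  | .inl .const => rd (rg .src)
  | .inl .pos => rd (rg .const)
  | .inl .nxt => rd (rg .nxt)
  | .inl .thr => rd (rg .const)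
  | _ => 0

/-- Keys of the copying layer. -/
def shiftK (l : ℝ) : Slot k N → Module.Dual ℝ (Slot k N → ℝ)
  | .inl .const => (2 * l) • rd (rg .pos)
  | .inl .pos => (-l) • rd (rg .posSq)
  | .inl .nxt => (2 * l) • rd (rg .pos)
  | .inl .thr => (-l) • rd (rg .posSq)
  | _ => 0

/-- Values of the copying layer. -/
def shiftV (U : Fin k → Fin N → ℝ) : Slot k N → Module.Dual ℝ (Slot k N → ℝ)
  | .inr (.inl (.util, a)) => ∑ i, U a i • rd (st .model i)
  | .inr (.inl (.utilPolya, a)) => ∑ i, U a i • rd (st .polya i)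
  | .inr (.inr (.outcome, i)) => rd (st .state i)
  | _ => 0

/-- The registers for expected utilities under the model (`false`) and under the urn (`true`). -/
def utilReg (b : Bool) : ActReg := if b then .utilPolya else .util

/-- The registers for the responses to the model (`false`) and to the urn (`true`). -/
def playReg (b : Bool) : ActReg := if b then .playPolya else .play

variable (U : Fin k → Fin N → ℝ) (τ : ℕ → ℝ) (θ : Fin T → Fin N) (μ : Bool → Fin T → Fin N → ℝ)

/-- The states of the tokens with next-token probabilities `μ false` (model) and `μ true` (urn). -/
def tokens (p : Fin T) : Slot k N → ℝ :=
  tokenSlots τ p (heldState θ p) (μ true p) (μ false p)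

/-- The states after the copying layer. -/
def shifted (l : ℝ) : Fin T → Slot k N → ℝ :=
  attn shiftOwner shiftQ (shiftK l) (shiftV U) (tokens τ θ μ)

/-- The prediction for round `n` sits at position `n` itself; expected utility is linear in it, so
it can be a value form. -/
theorem tendsto_shifted_util (b : Bool) (a : Fin k) (t n : Fin T) (hn : (n : ℕ) = t - k) :
    Tendsto (fun l => shifted U τ θ μ l t (ac (utilReg b) a)) atTop
      (𝓝 (∑ i, μ b n i * U a i)) := by
  have h := tendsto_attn_sharp (owner := shiftOwner) (q := shiftQ) (K := shiftK) (v := shiftV U)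
    (X := tokens τ θ μ) (t := t) (j := ac (utilReg b) a) n (Fin.le_def.2 (by omega))
    (by cases b <;> rfl) (fun l s _ => by
      have : shiftOwner (ac (utilReg b) a : Slot k N) = false := by cases b <;> rfl
      rw [this]
      simp only [scoreOf, Finset.sum_filter, Slot.sum_univ, Reg.sum_univ, ActReg.sum_univ,
        StReg.sum_univ]
      simp [shiftOwner, shiftQ, shiftK, tokens, tokenSlots, hn]
      ring)
  have hv : shiftV U (ac (utilReg b) a) (tokens τ θ μ n) = ∑ i, μ b n i * U a i := by
    cases b <;> simp [utilReg, shiftV, tokens, tokenSlots, mul_comm]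
  rwa [hv] at h

/-- The outcome of round `t - k` is held by the token one position later, whence a second head with
target `t + 1 - k`. For `t < k` the truncated target is BOS, which holds no state. -/
theorem tendsto_shifted_outcome (hk : 0 < k) (i : Fin N) (t n : Fin T) (hn : (n : ℕ) = t + 1 - k) :
    Tendsto (fun l => shifted U τ θ μ l t (st .outcome i)) atTop
      (𝓝 (if heldState θ n = some i then 1 else 0)) :=
  tendsto_attn_sharp (owner := shiftOwner) (q := shiftQ) (K := shiftK) (v := shiftV U)
    (X := tokens τ θ μ) (t := t) (j := st .outcome i) n (Fin.le_def.2 (by omega))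
    rfl (fun l s _ => by
      have : shiftOwner (st .outcome i : Slot k N) = true := rfl
      rw [this]
      simp only [scoreOf, Finset.sum_filter, Slot.sum_univ, Reg.sum_univ, ActReg.sum_univ,
        StReg.sum_univ]
      simp [shiftOwner, shiftQ, shiftK, tokens, tokenSlots, hn]
      ring)

/-! ### Quantal responses as attention to the first tokens -/

/-- The weights of a softmax over the first `k` positions. -/
def firstWeight (z : Fin k → ℝ) (s : ℕ) : ℝ := if h : s < k then Real.exp (z ⟨s, h⟩) else 0

/-- The softmax of `z` over those of the first `k` positions that `t` sees. -/
def softFirst (z : Fin k → ℝ) (t : Fin T) (a : Fin k) : ℝ :=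
  (∑ s ∈ Finset.Iic t, firstWeight z s * if (s : ℕ) = a then 1 else 0) /
    ∑ s ∈ Finset.Iic t, firstWeight z s

theorem firstWeight_nonneg (z : Fin k → ℝ) (s : ℕ) : 0 ≤ firstWeight z s := by
  unfold firstWeight; split_ifs <;> positivity

theorem sum_firstWeight_pos (hk : 0 < k) (z : Fin k → ℝ) (t : Fin T) :
    0 < ∑ s ∈ Finset.Iic t, firstWeight z (s : ℕ) := by
  have hT : 0 < T := by have := t.isLt; omega
  refine Finset.sum_pos' (fun s _ => firstWeight_nonneg z s)
    ⟨⟨0, hT⟩, Finset.mem_Iic.2 (Fin.le_def.2 (Nat.zero_le _)), ?_⟩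
  simp only [firstWeight, hk, dif_pos]
  positivity

theorem softFirst_nonneg (z : Fin k → ℝ) (t : Fin T) (a : Fin k) : 0 ≤ softFirst z t a :=
  div_nonneg (Finset.sum_nonneg fun s _ =>
    mul_nonneg (firstWeight_nonneg z s) (by split_ifs <;> norm_num))
    (Finset.sum_nonneg fun s _ => firstWeight_nonneg z s)

theorem softFirst_le_one (z : Fin k → ℝ) (t : Fin T) (a : Fin k) : softFirst z t a ≤ 1 :=
  div_le_one_of_le₀ (Finset.sum_le_sum fun s _ =>
    mul_le_of_le_one_right (firstWeight_nonneg z s) (by split_ifs <;> norm_num))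
    (Finset.sum_nonneg fun s _ => firstWeight_nonneg z s)

theorem sum_Iic_first (t : Fin T) (ht : k ≤ t) (f : ℕ → ℝ) (hf : ∀ s, k ≤ s → f s = 0) :
    ∑ s ∈ Finset.Iic t, f s = ∑ a : Fin k, f a := by
  symm
  have hT := t.isLt
  refine Finset.sum_of_injOn (fun a : Fin k => (⟨a, by omega⟩ : Fin T)) ?_ ?_ ?_ ?_
  · intro a _ b _ h
    exact Fin.ext (by simpa using h)
  · intro a _
    simp only [Finset.coe_Iic, Set.mem_Iic, Fin.le_def]
    omega
  · intro s _ hs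
    refine hf s (not_lt.1 fun h => hs ⟨⟨s, h⟩, by simp, rfl⟩)
  · intro a _; rfl

theorem softFirst_eq_qbr (μ : Fin N → ℝ) (ε : ℝ) (t : Fin T) (ht : k ≤ t) :
    softFirst (fun a => (∑ i, μ i * U a i) / ε) t = qbr U μ ε := by
  ext a
  unfold softFirst qbr
  rw [sum_Iic_first t ht (fun s => firstWeight _ s * if s = a then 1 else 0)
      fun s hs => by simp [firstWeight, not_lt.2 hs],
    sum_Iic_first t ht (firstWeight _) fun s hs => by simp [firstWeight, not_lt.2 hs]]
  simp [firstWeight, Fin.val_inj]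

/-- Owners of the columns of the response layer. -/
def playOwner : Slot k N → Bool
  | .inr (.inl (.playPolya, _)) => true
  | _ => false

/-- Queries of the response layer. -/
def playQ (ε l : ℝ) : Slot k N → Module.Dual ℝ (Slot k N → ℝ)
  | .inr (.inl (.play, a)) => ε⁻¹ • rd (ac .util a) + l • rd (rg .const)
  | .inr (.inl (.playPolya, a)) => ε⁻¹ • rd (ac .utilPolya a) + l • rd (rg .const)
  | _ => 0

/-- Keys and values of the response layer. -/
def playV : Slot k N → Module.Dual ℝ (Slot k N → ℝ)
  | .inr (.inl (.play, a)) => rd (ac .first a)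
  | .inr (.inl (.playPolya, a)) => rd (ac .first a)
  | _ => 0

/-- The states after the response layer. -/
def played (ε l : ℝ) : Fin T → Slot k N → ℝ :=
  attn playOwner (playQ ε l) playV playV (shifted U τ θ μ l)

theorem shifted_first (l : ℝ) (t : Fin T) (a : Fin k) :
    shifted U τ θ μ l t (ac .first a) = if (t : ℕ) = a then 1 else 0 :=
  attn_of_value_eq_zero rfl _ _

theorem shifted_const (l : ℝ) (t : Fin T) : shifted U τ θ μ l t (rg .const) = 1 :=
  attn_of_value_eq_zero rfl _ _

/-- The keys are one-hot on the first `k` positions, so token `a` gets score `utility / ε + l` and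
every later token gets `0`. After removing the shift `l`, the former converge and the latter get
weight `exp (-l)`, which vanishes. -/
theorem tendsto_played (hk : 0 < k) (ε : ℝ) (b : Bool) (a : Fin k) (t n : Fin T)
    (hn : (n : ℕ) = t - k) :
    Tendsto (fun l => played U τ θ μ ε l t (ac (playReg b) a)) atTop
      (𝓝 (softFirst (fun a => (∑ i, μ b n i * U a i) / ε) t a)) := by
  have hs : ∀ l (s : Fin T), scoreOf playOwner (playQ ε l) playV (shifted U τ θ μ l) b t s =
      ∑ a : Fin k, (ε⁻¹ * shifted U τ θ μ l t (ac (utilReg b) a) + l) *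
        if (s : ℕ) = a then 1 else 0 := by
    intro l s
    simp only [scoreOf, Finset.sum_filter, Slot.sum_univ, Reg.sum_univ, ActReg.sum_univ,
      StReg.sum_univ]
    cases b <;> simp [playOwner, playQ, playV, shifted_first, shifted_const,
        utilReg]
  have ho : playOwner (ac (playReg b) a : Slot k N) = b := by cases b <;> rfl
  have hx : ∀ l, shifted U τ θ μ l t (ac (playReg b) a) = 0 := fun l => by
    cases b <;> exact attn_of_value_eq_zero rfl _ _
  have hv : ∀ l (s : Fin T), playV (ac (playReg b) a) (shifted U τ θ μ l s) =
      if (s : ℕ) = a then 1 else 0 := fun l s => by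
    cases b <;> simp [playReg, playV, shifted_first]
  have := tendsto_attn (owner := playOwner) (q := playQ ε) (k := fun _ => playV)
    (v := fun _ => playV) (X := shifted U τ θ μ) (t := t) (j := ac (playReg b) a) (x := 0)
    (fun l => l) (fun s => firstWeight (fun a => (∑ i, μ b n i * U a i) / ε) s)
    (fun s => if (s : ℕ) = a then 1 else 0) (by simp [hx])
    (fun s _ => by
      simp only [ho, hs]
      by_cases h : (s : ℕ) < k
      · have : ∀ l, (∑ a : Fin k, (ε⁻¹ * shifted U τ θ μ l t (ac (utilReg b) a) + l) *
            if (s : ℕ) = a then 1 else 0) - l =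
            ε⁻¹ * shifted U τ θ μ l t (ac (utilReg b) ⟨s, h⟩) := by
          intro l
          rw [Finset.sum_eq_single (⟨s, h⟩ : Fin k)]
          · simp
          · intro c _ hc
            rw [if_neg fun h' => hc (Fin.ext h'.symm), mul_zero]
          · simp
        simp only [this, firstWeight, dif_pos h, div_eq_inv_mul]
        exact (Real.continuous_exp.tendsto _).comp
          ((tendsto_shifted_util U τ θ μ b ⟨s, h⟩ t n hn).const_mul _)
      · have : ∀ a : Fin k, (s : ℕ) ≠ a := fun a => by have := a.isLt; omega
        simp only [firstWeight, dif_neg h, this, if_false, mul_zero, Finset.sum_const_zero,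
          zero_sub]
        exact Real.tendsto_exp_neg_atTop_nhds_zero)
    (fun s _ => by simp [hv]) (sum_firstWeight_pos hk _ t).ne'
  rwa [zero_add] at this

/-! ### The gain of the urn over the model in one round -/

/-- The neurons that select the expected utility under the outcome. -/
def gainForm : Bool × Fin N → Module.Dual ℝ (Slot k N → ℝ) := fun n =>
  ∑ a, U a n.2 • rd (ac (playReg n.1) a) + (2 * ((k : ℝ) + 1)) • rd (st .outcome n.2)

/-- The combination of the neurons `gainForm`. -/
def gainOut : (Bool × Fin N → ℝ) →ₗ[ℝ] (Slot k N → ℝ) :=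
  LinearMap.single ℝ (fun _ => ℝ) (rg .gain) ∘ₗ
    ∑ i : Fin N, ((LinearMap.proj (true, i) : Module.Dual ℝ (Bool × Fin N → ℝ)) -
      LinearMap.proj (false, i))

/-- The states after the gain has been computed. -/
def gained (ε l : ℝ) (p : Fin T) : Slot k N → ℝ :=
  played U τ θ μ ε l p +
    gainOut fun n => max (gainForm U n (played U τ θ μ ε l p) + -((k : ℝ) + 1)) 0

/-- The limit of the gains. -/
def gainLim (ε : ℝ) (t : Fin T) : ℝ :=
  if k ≤ t then
    let r : Fin T := ⟨t - k, lt_of_le_of_lt (Nat.sub_le _ _) t.isLt⟩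
    ∑ a, qbr U (μ true r) ε a * U a (θ r) - ∑ a, qbr U (μ false r) ε a * U a (θ r)
  else 0

theorem played_gain (ε l : ℝ) (t : Fin T) : played U τ θ μ ε l t (rg .gain) = 0 :=
  (attn_of_value_eq_zero rfl _ _).trans (attn_of_value_eq_zero rfl _ _)

theorem played_outcome (ε l : ℝ) (t : Fin T) (i : Fin N) :
    played U τ θ μ ε l t (st .outcome i) = shifted U τ θ μ l t (st .outcome i) :=
  attn_of_value_eq_zero rfl _ _

/-- A product of a bounded number and a bit is computed by a ReLU gate: the utility against each
possible state is kept only for the realized one. The offset added by the gate cancels between urn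
and model. -/
theorem tendsto_gained (hU : ∀ a i, |U a i| ≤ 1) (hk : 0 < k) (ε : ℝ) (t : Fin T) :
    Tendsto (fun l => gained U τ θ μ ε l t (rg .gain)) atTop (𝓝 (gainLim U θ μ ε t)) := by
  set r : Fin T := ⟨t - k, lt_of_le_of_lt (Nat.sub_le _ _) t.isLt⟩ with hr
  set n : Fin T := ⟨t + 1 - k, by have := t.isLt; omega⟩ with hn
  let V (b : Bool) (i : Fin N) : ℝ :=
    ∑ a, U a i * softFirst (fun a => (∑ i, μ b r i * U a i) / ε) t a
  let o (i : Fin N) : ℝ := if heldState θ n = some i then 1 else 0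
  have h1 : Tendsto (fun l => gained U τ θ μ ε l t (rg .gain)) atTop
      (𝓝 (∑ i, (max (V true i + 2 * ((k : ℝ) + 1) * o i + -((k : ℝ) + 1)) 0 -
        max (V false i + 2 * ((k : ℝ) + 1) * o i + -((k : ℝ) + 1)) 0))) := by
    have hform : ∀ b i, Tendsto (fun l => max (gainForm U (b, i) (played U τ θ μ ε l t) +
        -((k : ℝ) + 1)) 0) atTop
        (𝓝 (max (V b i + 2 * ((k : ℝ) + 1) * o i + -((k : ℝ) + 1)) 0)) := by
      intro b i
      simp only [gainForm, LinearMap.add_apply, LinearMap.sum_apply, LinearMap.smul_apply,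
        LinearMap.proj_apply, smul_eq_mul, played_outcome]
      refine Tendsto.max (Tendsto.add_const _ (Tendsto.add (tendsto_finsetSum _ fun a _ => ?_) ?_))
        tendsto_const_nhds
      · exact (tendsto_played U τ θ μ hk ε b a t r rfl).const_mul _
      · exact (tendsto_shifted_outcome U τ θ μ hk i t n rfl).const_mul _
    have : ∀ l, gained U τ θ μ ε l t (rg .gain) = ∑ i,
        (max (gainForm U (true, i) (played U τ θ μ ε l t) + -((k : ℝ) + 1)) 0 -
         max (gainForm U (false, i) (played U τ θ μ ε l t) + -((k : ℝ) + 1)) 0) := by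
      intro l
      simp [gained, gainOut, played_gain]
    simp only [this]
    exact tendsto_finsetSum _ fun i _ => (hform true i).sub (hform false i)
  -- The crude bound by `k`, from weights in `[0, 1]`, also covers positions that do not see all
  -- first `k` tokens; it explains the gate constant `k + 1`.
  have hV : ∀ b i, |V b i| ≤ k := by
    intro b i
    calc |V b i| ≤ ∑ a : Fin k, |U a i * softFirst (fun a => (∑ i, μ b r i * U a i) / ε) t a| :=
          Finset.abs_sum_le_sum_abs _ _
      _ ≤ ∑ a : Fin k, (1 : ℝ) := Finset.sum_le_sum fun a _ => by
          rw [abs_mul, abs_of_nonneg (softFirst_nonneg _ t a)]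
          exact mul_le_one₀ (hU a i) (softFirst_nonneg _ t a) (softFirst_le_one _ t a)
      _ = k := by simp
  have hgate : ∀ b i, max (V b i + 2 * ((k : ℝ) + 1) * o i + -((k : ℝ) + 1)) 0 =
      (V b i + ((k : ℝ) + 1)) * o i := by
    intro b i
    have := abs_le.1 (hV b i)
    by_cases h : heldState θ n = some i
    · simp only [o, if_pos h]
      rw [max_eq_left (by linarith)]; ring
    · simp only [o, if_neg h]
      rw [max_eq_right (by linarith)]; ring
  convert h1 using 2
  simp only [hgate, ← sub_mul, add_sub_add_right_eq_sub]
  unfold gainLim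
  split_ifs with htk
  · have hheld : heldState θ n = some (θ r) := by
      have h0 : (n : ℕ) ≠ 0 := by simp only [hn]; omega
      rw [heldState, if_neg h0]
      congr 2
      ext
      simp only [hn, hr]; omega
    simp only [o, hheld, Option.some.injEq, mul_ite, mul_one, mul_zero, Finset.sum_ite_eq,
      Finset.mem_univ, if_true, V, softFirst_eq_qbr U _ ε t htk]
    simp only [mul_comm, ← hr]
  -- Here `t + 1 - k = 0`, so the copied token is BOS and all gates are closed.
  · have hheld : heldState θ n = none := by
      rw [heldState, if_pos (by simp only [hn]; omega)]
    simp [o, hheld]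

end tail

/-! ### Regrets -/

/-- In a difference of regrets the best fixed action cancels. -/
theorem extReg_sub_extReg {T k N : ℕ} (hk : 0 < k) (U : Fin k → Fin N → ℝ)
    (π π' : Fin T → Fin k → ℝ) (θ : Fin T → Fin N) (s : ℕ) :
    extReg U π θ s - extReg U π' θ s = (1 / (s : ℝ)) *
      ∑ r ∈ Finset.univ.filter (fun r : Fin T => (r : ℕ) < s),
        (∑ a, π' r a * U a (θ r) - ∑ a, π r a * U a (θ r)) := by
  have : Nonempty (Fin k) := ⟨⟨0, hk⟩⟩
  have h : ∀ π : Fin T → Fin k → ℝ, extReg U π θ s =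
      (⨆ b : Fin k, (1 / (s : ℝ)) *
        ∑ r ∈ Finset.univ.filter (fun r : Fin T => (r : ℕ) < s), U b (θ r)) -
      (1 / (s : ℝ)) * ∑ r ∈ Finset.univ.filter (fun r : Fin T => (r : ℕ) < s),
        ∑ a, π r a * U a (θ r) := by
    intro π
    rw [ciSup_sub (Set.finite_range _).bddAbove]
    simp only [extReg, Finset.sum_sub_distrib, mul_sub]
  rw [h, h, Finset.sum_sub_distrib]
  ring

theorem nextTokenProb_nonneg {T N : ℕ} (D : PMF (Fin T → Fin N)) (θ : Fin T → Fin N) (t : Fin T)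
    (i : Fin N) : 0 ≤ nextTokenProb D θ t i :=
  div_nonneg (Finset.sum_nonneg fun _ _ => ENNReal.toReal_nonneg)
    (Finset.sum_nonneg fun _ _ => ENNReal.toReal_nonneg)

theorem nextTokenProb_le_one {T N : ℕ} (D : PMF (Fin T → Fin N)) (θ : Fin T → Fin N) (t : Fin T)
    (i : Fin N) : nextTokenProb D θ t i ≤ 1 := by
  refine div_le_one_of_le₀ (Finset.sum_le_sum_of_subset_of_nonneg ?_ fun _ _ _ =>
    ENNReal.toReal_nonneg) (Finset.sum_nonneg fun _ _ => ENNReal.toReal_nonneg)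
  intro x hx
  simp only [Finset.mem_filter] at hx ⊢
  exact ⟨hx.1, hx.2.1⟩

theorem polya_nonneg {T N : ℕ} (θ : Fin T → Fin N) (t : Fin T) (i : Fin N) : 0 ≤ polya θ t i := by
  unfold polya; positivity

theorem polya_le_one {T N : ℕ} (θ : Fin T → Fin N) (t : Fin T) (i : Fin N) : polya θ t i ≤ 1 := by
  have hN : 1 ≤ N := by have := i.isLt; omega
  refine div_le_one_of_le₀ ?_ (by positivity)
  have h : Finset.card {s : Fin T | s < t ∧ θ s = i} ≤ (t : ℕ) := by
    calc _ ≤ (Finset.Iio t).card := Finset.card_le_card fun s hs => by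
          simp only [Finset.mem_filter] at hs
          exact Finset.mem_Iio.2 hs.2.1
      _ = t := Fin.card_Iio t
  exact_mod_cast Nat.add_le_add hN h

section tail

variable {k N T : ℕ} (U : Fin k → Fin N → ℝ) (τ : ℕ → ℝ) (θ : Fin T → Fin N)
  (μ : Bool → Fin T → Fin N → ℝ)

/-! ### Averaging the gains and comparing with the threshold -/

/-- Values of the averaging layer. -/
def avgV : Slot k N → Module.Dual ℝ (Slot k N → ℝ)
  | .inl .avg => rd (rg .gain)
  | _ => 0

/-- The states after the averaging layer. -/
def averaged (ε l : ℝ) : Fin T → Slot k N → ℝ :=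
  attn (fun _ => ()) 0 0 avgV (gained U τ θ μ ε l)

/-- The limit of the averages. -/
def avgLim (ε : ℝ) (t : Fin T) : ℝ :=
  (∑ s ∈ Finset.Iic t, gainLim U θ μ ε s) / ((t : ℕ) + 1)

theorem gained_apply (ε l : ℝ) (t : Fin T) (j : Slot k N) (hj : j ≠ rg .gain) :
    gained U τ θ μ ε l t j = played U τ θ μ ε l t j := by
  simp [gained, gainOut, hj]

theorem tendsto_averaged (hU : ∀ a i, |U a i| ≤ 1) (hk : 0 < k) (ε : ℝ) (t : Fin T) :
    Tendsto (fun l => averaged U τ θ μ ε l t (rg .avg)) atTop (𝓝 (avgLim U θ μ ε t)) := by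
  have h0 : ∀ l, gained U τ θ μ ε l t (rg .avg) = 0 := fun l =>
    (gained_apply U τ θ μ ε l t _ (by simp)).trans
      ((attn_of_value_eq_zero rfl _ _).trans (attn_of_value_eq_zero rfl _ _))
  simp only [averaged, attn_of_query_eq_zero, h0, zero_add, avgV, LinearMap.proj_apply, avgLim]
  exact (tendsto_finsetSum _ fun s _ => tendsto_gained U τ θ μ hU hk ε s).div_const _

theorem avgLim_of_lt (ε : ℝ) (t : Fin T) (ht : (t : ℕ) < k) : avgLim U θ μ ε t = 0 := by
  rw [avgLim, Finset.sum_eq_zero, zero_div]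
  intro s hs
  have : (s : ℕ) ≤ t := Fin.le_def.1 (Finset.mem_Iic.1 hs)
  rw [gainLim, if_neg (by omega)]

/-- Attention divides by the `t + 1` visible positions, of which only `s` carry the gain of a round;
this produces the factor `s / (t + 1)`, which the stored threshold shares. -/
theorem avgLim_eq (hk : 0 < k) (ε : ℝ) (t : Fin T) (s : ℕ) (hs : 1 ≤ s) (hst : s + k = t + 1) :
    avgLim U θ μ ε t = (s / ((t : ℕ) + 1)) *
      (extReg U (fun r => qbr U (μ false r) ε) θ s - extReg U (fun r => qbr U (μ true r) ε) θ s) := by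
  have hs0 : (s : ℝ) ≠ 0 := by positivity
  rw [extReg_sub_extReg hk, avgLim, sum_Iic_shift k t _ (fun r =>
    ∑ a, qbr U (μ true r) ε a * U a (θ r) - ∑ a, qbr U (μ false r) ε a * U a (θ r))]
  · have : (Finset.univ.filter fun r : Fin T => (r : ℕ) + k ≤ t) =
        Finset.univ.filter fun r : Fin T => (r : ℕ) < s := by
      ext r
      simp only [Finset.mem_filter, Finset.mem_univ, true_and]
      omega
    rw [this]
    field_simp
  · intro r hr
    rw [gainLim, if_neg (by omega)]
  · intro r r' hr
    have : (⟨(r' : ℕ) - k, lt_of_le_of_lt (Nat.sub_le _ _) r'.isLt⟩ : Fin T) = r :=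
      Fin.ext (by simp only; omega)
    rw [gainLim, if_pos (by omega), this]

/-- The neuron that compares the average with the threshold. -/
def flagForm (κ : ℝ) : Unit → Module.Dual ℝ (Slot k N → ℝ) := fun _ =>
  κ • (rd (rg .avg) - rd (rg .thr))

/-- Writing the neuron `flagForm`. -/
def flagOut : (Unit → ℝ) →ₗ[ℝ] (Slot k N → ℝ) :=
  LinearMap.single ℝ (fun _ => ℝ) (rg .flag) ∘ₗ LinearMap.proj ()

/-- The states after the comparison. -/
def flagged (ε l κ : ℝ) (p : Fin T) : Slot k N → ℝ :=
  averaged U τ θ μ ε l p +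
    flagOut fun n => max (flagForm κ n (averaged U τ θ μ ε l p) + 0) 0

/-- Values of the layer that collects the flags. -/
def anyV : Slot k N → Module.Dual ℝ (Slot k N → ℝ)
  | .inl .any => rd (rg .flag)
  | _ => 0

/-- The states after the flags have been collected. -/
def collected (ε l κ : ℝ) : Fin T → Slot k N → ℝ :=
  attn (fun _ => ()) 0 0 anyV (flagged U τ θ μ ε l κ)

/-- A register that no layer writes keeps its token value exactly, for every sharpness; this is why
the predictions stay exact. -/
theorem averaged_of_unused (ε l : ℝ) (t : Fin T) (j : Slot k N) (h1 : avgV j = 0)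
    (h2 : j ≠ rg .gain) (h3 : playV j = 0) (h4 : shiftV U j = 0) :
    averaged U τ θ μ ε l t j = tokens τ θ μ t j :=
  (attn_of_value_eq_zero h1 _ _).trans ((gained_apply U τ θ μ ε l t _ h2).trans
    ((attn_of_value_eq_zero h3 _ _).trans (attn_of_value_eq_zero h4 _ _)))

theorem flagged_apply (ε l κ : ℝ) (t : Fin T) (j : Slot k N) (hj : j ≠ rg .flag) :
    flagged U τ θ μ ε l κ t j = averaged U τ θ μ ε l t j := by
  simp [flagged, flagOut, hj]

theorem collected_any (ε l κ : ℝ) (t : Fin T) : collected U τ θ μ ε l κ t (rg .any) =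
    (∑ s ∈ Finset.Iic t, max (κ * (averaged U τ θ μ ε l s (rg .avg) - τ s)) 0) /
      ((t : ℕ) + 1) := by
  have h0 : flagged U τ θ μ ε l κ t (rg .any) = 0 :=
    (flagged_apply U τ θ μ ε l κ t _ (by simp)).trans
      (averaged_of_unused U τ θ μ ε l t _ rfl (by simp) rfl rfl)
  have h1 : ∀ s, averaged U τ θ μ ε l s (rg .thr) = τ s := fun s =>
    averaged_of_unused U τ θ μ ε l s _ rfl (by simp) rfl rfl
  have h2 : ∀ s, averaged U τ θ μ ε l s (rg .flag) = 0 := fun s =>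
    averaged_of_unused U τ θ μ ε l s _ rfl (by simp) rfl rfl
  simp only [collected, attn_of_query_eq_zero, h0, zero_add, anyV, LinearMap.proj_apply]
  simp [flagged, flagOut, flagForm, h1, h2]

theorem collected_model (ε l κ : ℝ) (t : Fin T) (i : Fin N) :
    collected U τ θ μ ε l κ t (st .model i) = μ false t i :=
  (attn_of_value_eq_zero rfl _ _).trans ((flagged_apply U τ θ μ ε l κ t _ (by simp)).trans
      (averaged_of_unused U τ θ μ ε l t _ rfl (by simp) rfl rfl))

theorem collected_polya (ε l κ : ℝ) (t : Fin T) (i : Fin N) :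
    collected U τ θ μ ε l κ t (st .polya i) = μ true t i :=
  (attn_of_value_eq_zero rfl _ _).trans ((flagged_apply U τ θ μ ε l κ t _ (by simp)).trans
      (averaged_of_unused U τ θ μ ε l t _ rfl (by simp) rfl rfl))

/-! ### The output -/

/-- The output: the urn if `T` times the collected flag is at least one, the model if it is zero. -/
def readout (T : ℕ) (x : Slot k N → ℝ) (i : Fin N) : ℝ :=
  max (x (st .model i) - T * x (rg .any)) 0 - max (x (st .polya i) - T * x (rg .any)) 0 +
    x (st .polya i)

/-- Probabilities are at most one, so both ReLUs are switched off and only the urn remains. -/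
theorem readout_of_one_le {x : Slot k N → ℝ} (hx : 1 ≤ T * x (rg .any))
    (h1 : ∀ i, x (st .model i) ≤ 1) (h2 : ∀ i, x (st .polya i) ≤ 1) :
    readout T x = fun i => x (st .polya i) := by
  ext i
  have := h1 i
  have := h2 i
  rw [readout, max_eq_right (by linarith), max_eq_right (by linarith)]
  ring

/-- Probabilities are nonnegative, so both ReLUs act as the identity and the urn terms cancel. -/
theorem readout_of_eq_zero {x : Slot k N → ℝ} (hx : x (rg .any) = 0)
    (h1 : ∀ i, 0 ≤ x (st .model i)) (h2 : ∀ i, 0 ≤ x (st .polya i)) :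
    readout T x = fun i => x (st .model i) := by
  ext i
  rw [readout, hx, mul_zero, sub_zero, sub_zero, max_eq_left (h1 i), max_eq_left (h2 i)]
  ring

/-- The final four attention layers and their multi-layer perceptrons. -/
theorem exists_tail (T : ℕ) {m m' : ℕ} (e : Fin m ⊕ Slot k N ≃ Fin m') (ε l κ : ℝ) :
    ∃ (bs : List (Attention m' × MLP m' m')) (f : Attention m') (M : MLP m' N),
      bs.length = 3 ∧
      (∀ b ∈ bs, b.1.heads ≤ 3 ∧ b.2.width ≤ 2 * N + 1 + 2 * Fintype.card (Slot k N) ∧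
        b.2.depth ≤ 1) ∧
      f.heads ≤ 3 ∧ M.width ≤ 4 * N ∧ M.depth = 1 ∧
      ∀ (θ : Fin T → Fin N) (μ : Bool → Fin T → Fin N → ℝ) (t : Fin T),
        M.eval (f.layer (bs.foldl blockStep (encode e (sideBySide 0 (tokens τ θ μ)))) t) =
          readout T (collected U τ θ μ ε l κ t) := by
  have dB : Bool ≃ Fin 2 := finTwoEquiv.symm
  have dU : Unit ≃ Fin 1 := finOneEquiv.symm
  obtain ⟨f₁, h₁, hf₁⟩ := exists_tail_attention e dB shiftOwner shiftQ (shiftK l) (shiftV U)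
  obtain ⟨f₂, h₂, hf₂⟩ := exists_tail_attention e dB playOwner (playQ ε l) playV playV
  obtain ⟨f₃, h₃, hf₃⟩ := exists_tail_attention e dU (fun _ => ()) 0 0 avgV
  obtain ⟨f₄, h₄, hf₄⟩ := exists_tail_attention e dU (fun _ => ()) 0 0 anyV
  obtain ⟨M₂, w₂, d₂, hM₂⟩ := exists_tail_mlp e (gainForm U) (fun _ => -((k : ℝ) + 1)) gainOut
  obtain ⟨M₃, w₃, d₃, hM₃⟩ := exists_tail_mlp e (flagForm κ) (fun _ => 0) flagOut
  obtain ⟨M, w, d, hM⟩ := MLP.exists_hidden e (Equiv.refl (Fin N))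
    (fun n : Bool × Fin N => (rd (st (if n.1 then .model else .polya) n.2) - (T : ℝ) • rd (rg .any))
      ∘ₗ LinearMap.funLeft ℝ ℝ Sum.inr) (fun _ => 0)
    (LinearMap.funLeft ℝ ℝ (fun i => (true, i)) - LinearMap.funLeft ℝ ℝ (fun i => (false, i)))
    (LinearMap.pi fun i => rd (st .polya i) ∘ₗ LinearMap.funLeft ℝ ℝ Sum.inr) LinearMap.id
  -- No computation is needed between copying and responding, so the first perceptron is the
  -- identity.
  refine ⟨[(f₁, .affine 1 0), (f₂, M₂), (f₃, M₃)], f₄, M, rfl, ?_, by omega,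
    ?_, d, fun θ μ t => ?_⟩
  · simp only [List.forall_mem_cons, MLP.width, MLP.depth]
    simp only [Fintype.card_prod, Fintype.card_bool, Fintype.card_fin, Fintype.card_unit] at w₂ w₃
    refine ⟨⟨by omega, by omega, by omega⟩, ⟨by omega, by omega, by omega⟩,
      ⟨by omega, by omega, by omega⟩, by simp⟩
  · simp only [Fintype.card_prod, Fintype.card_bool, Fintype.card_fin] at w
    omega
  · have e₁ : blockStep (encode e (sideBySide 0 (tokens τ θ μ))) (f₁, .affine 1 0) =
        encode e (sideBySide 0 (shifted U τ θ μ l)) := by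
      ext p j
      simp [blockStep, MLP.eval, hf₁, shifted]
    have e₂ : blockStep (encode e (sideBySide 0 (shifted U τ θ μ l))) (f₂, M₂) =
        encode e (sideBySide 0 (gained U τ θ μ ε l)) := by
      ext p j
      rw [blockStep, hf₂, hM₂]
      rfl
    have e₃ : blockStep (encode e (sideBySide 0 (gained U τ θ μ ε l))) (f₃, M₃) =
        encode e (sideBySide 0 (flagged U τ θ μ ε l κ)) := by
      ext p j
      rw [blockStep, hf₃, hM₃]
      rfl
    simp only [List.foldl_cons, List.foldl_nil, e₁, e₂, e₃]
    rw [hf₄]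
    refine (hM (sideBySide (m := m) 0 (collected U τ θ μ ε l κ) t)).trans ?_
    have : LinearMap.funLeft ℝ ℝ Sum.inr
      (sideBySide (m := m) 0 (collected U τ θ μ ε l κ) t) = collected U τ θ μ ε l κ t := rfl
    ext i
    simp [LinearMap.comp_apply, this, readout, LinearMap.funLeft_apply]

end tail

variable {k N T : ℕ}

/-! ### The switching rule -/

/-- The threshold at position `p`, where the regrets after `p + 1 - k` rounds are compared. -/
def threshold (T k : ℕ) (α : ℝ) (p : ℕ) : ℝ :=
  if k ≤ p then ((p + 1 - k : ℕ) : ℝ) / ((p : ℝ) + 1) * margin T k α (p + 1 - k) else 1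

/-- The next-token probabilities of `D` (`false`) and of the urn (`true`). -/
def nextProbs (D : PMF (Fin T → Fin N)) (θ : Fin T → Fin N) (b : Bool) : Fin T → Fin N → ℝ :=
  if b then polya θ else nextTokenProb D θ

theorem avgLim_sub_threshold (hk : 0 < k) (U : Fin k → Fin N → ℝ) (D : PMF (Fin T → Fin N))
    (θ : Fin T → Fin N) (α : ℝ) (t : Fin T) (s : ℕ) (hs : 1 ≤ s) (hst : s + k = t + 1) :
    avgLim U θ (nextProbs D θ) (1 / Real.sqrt T) t - threshold T k α t =
      (s / ((t : ℕ) + 1)) * (regret U D θ s - regretHedge U θ s - margin T k α s) := by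
  rw [avgLim_eq U θ _ hk _ t s hs hst, threshold, if_pos (by omega),
    show (t : ℕ) + 1 - k = s by omega]
  simp only [nextProbs, if_true, Bool.false_eq_true, if_false, regret, regretHedge]
  ring

/-- If the averages are accurate, the readout follows the switching rule. -/
theorem readout_collected (hk : 0 < k) (U : Fin k → Fin N → ℝ) (D : PMF (Fin T → Fin N))
    (θ : Fin T → Fin N) {α l δ : ℝ} (hδ : 0 < δ) (hδ1 : δ ≤ 1)
    (hl : ∀ t, |averaged U (threshold T k α) θ (nextProbs D θ) (1 / Real.sqrt T) l t (rg .avg) -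
      avgLim U θ (nextProbs D θ) (1 / Real.sqrt T) t| < δ / (2 * T)) (t : Fin T) :
    ((∃ s : ℕ, 1 ≤ s ∧ s + k ≤ (t : ℕ) + 1 ∧
        regretHedge U θ s + margin T k α s + δ ≤ regret U D θ s) →
      readout T (collected U (threshold T k α) θ (nextProbs D θ) (1 / Real.sqrt T) l (2 * T / δ) t) =
        polya θ t) ∧
    ((∀ s : ℕ, 1 ≤ s → s + k ≤ (t : ℕ) + 1 →
        regret U D θ s < regretHedge U θ s + margin T k α s - δ) →
      readout T (collected U (threshold T k α) θ (nextProbs D θ) (1 / Real.sqrt T) l (2 * T / δ) t) =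
        nextTokenProb D θ t) := by
  have hT1 : 1 ≤ T := by have := t.isLt; omega
  have hT : (1 : ℝ) ≤ T := by exact_mod_cast hT1
  have hT0 : (0 : ℝ) < T := by linarith
  have hκ : 0 < 2 * (T : ℝ) / δ := by positivity
  have hfrac : ∀ (p : Fin T) (s : ℕ), 1 ≤ s → 1 / (T : ℝ) ≤ s / ((p : ℕ) + 1) := by
    intro p s hs
    have h1 : ((p : ℕ) : ℝ) + 1 ≤ T := by exact_mod_cast p.isLt
    have h2 : (1 : ℝ) ≤ s := by exact_mod_cast hs
    exact div_le_div₀ (by linarith) h2 (by positivity) h1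
  -- A regret gap of `δ` becomes at least `δ / T` after scaling by `s / (p + 1)`. One half absorbs
  -- the approximation error; the other is what the slope `2T / δ` amplifies to one.
  have h2T : δ / T = δ / (2 * T) + δ / (2 * T) := by field_simp; ring
  constructor
  · rintro ⟨s, hs, hst, hreg⟩
    rw [readout_of_one_le]
    · ext i; rw [collected_polya]; rfl
    -- The position at which exactly the first `s` rounds have been averaged.
    · let p : Fin T := ⟨s + k - 1, by have := t.isLt; omega⟩
      have hp : s + k = p + 1 := by simp only [p]; omega
      have hd := avgLim_sub_threshold hk U D θ α p s hs hp
      have h1 : δ / T ≤ (s / ((p : ℕ) + 1)) *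
          (regret U D θ s - regretHedge U θ s - margin T k α s) := by
        rw [div_eq_mul_one_div, mul_comm]
        exact mul_le_mul (hfrac p s hs) (by linarith) hδ.le (by positivity)
      have h2 := (abs_lt.1 (hl p)).1
      rw [collected_any, mul_div_assoc', one_le_div (by positivity)]
      have h3 : (1 : ℝ) ≤ ∑ s ∈ Finset.Iic t, max (2 * T / δ * (averaged U (threshold T k α) θ
          (nextProbs D θ) (1 / Real.sqrt T) l s (rg .avg) - threshold T k α s)) 0 := by
        refine le_trans ?_ (Finset.single_le_sum (fun _ _ => le_max_right _ _)
          (Finset.mem_Iic.2 (show p ≤ t from Fin.le_def.2 (by simp only [p]; omega))))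
        refine le_max_of_le_left ?_
        calc (1 : ℝ) = 2 * T / δ * (δ / (2 * T)) := by field_simp
          _ ≤ _ := mul_le_mul_of_nonneg_left (by linarith) hκ.le
      have h4 : ((t : ℕ) : ℝ) + 1 ≤ T := by exact_mod_cast t.isLt
      -- The sum of flags is at least one, and `T ≥ t + 1` undoes the averaging.
      nlinarith
    · intro i; rw [collected_model]; exact nextTokenProb_le_one D θ t i
    · intro i; rw [collected_polya]; exact polya_le_one θ t i
  · intro hreg
    rw [readout_of_eq_zero]
    · ext i; rw [collected_model]; rfl
    · rw [collected_any, Finset.sum_eq_zero, zero_div]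
      intro p hp
      have hpt : (p : ℕ) ≤ t := Fin.le_def.1 (Finset.mem_Iic.1 hp)
      refine max_eq_right (mul_nonpos_of_nonneg_of_nonpos hκ.le ?_)
      have h2 := (abs_lt.1 (hl p)).2
      have h5 : δ / (2 * T) ≤ 1 := (div_le_one (by positivity)).2 (by linarith)
      by_cases hpk : k ≤ p
      · have hd := avgLim_sub_threshold hk U D θ α p (p + 1 - k) (by omega) (by omega)
        have hr := hreg (p + 1 - k) (by omega) (by omega)
        have h1 : δ / T ≤ (((p : ℕ) + 1 - k : ℕ) / ((p : ℕ) + 1)) *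
            (margin T k α (p + 1 - k) + regretHedge U θ (p + 1 - k) - regret U D θ (p + 1 - k)) := by
          rw [div_eq_mul_one_div, mul_comm]
          exact mul_le_mul (hfrac p _ (by omega)) (by linarith) hδ.le (by positivity)
        have h6 : 0 < δ / (2 * T) := by positivity
        linarith
      -- Before position `k` no round has been evaluated: the limit is `0`, and the artificial
      -- threshold `1` is not exceeded within the error.
      · rw [avgLim_of_lt U θ _ _ p (by omega)] at h2
        rw [threshold, if_neg hpk]
        linarith
    · intro i; rw [collected_model]; exact nextTokenProb_nonneg D θ t i
    · intro i; rw [collected_polya]; exact polya_nonneg θ t i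

/-- For some sharpness of the attention, all averages are accurate. -/
theorem exists_sharpness (hk : 0 < k) (U : Fin k → Fin N → ℝ) (hU : ∀ a i, |U a i| ≤ 1)
    (τ : ℕ → ℝ) (D : PMF (Fin T → Fin N)) (ε : ℝ) {e : ℝ} (he : 0 < e) :
    ∃ l, ∀ (θ : Fin T → Fin N) (t : Fin T),
      |averaged U τ θ (nextProbs D θ) ε l t (rg .avg) - avgLim U θ (nextProbs D θ) ε t| < e := by
  have : ∀ᶠ l in atTop, ∀ (θ : Fin T → Fin N) (t : Fin T),
      |averaged U τ θ (nextProbs D θ) ε l t (rg .avg) - avgLim U θ (nextProbs D θ) ε t| < e := by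
    -- Finitely many state sequences and positions allow a common sharpness.
    rw [eventually_all]
    intro θ
    rw [eventually_all]
    intro t
    exact (Metric.tendsto_nhds.1 (tendsto_averaged U τ θ (nextProbs D θ) hU hk ε t)) e he
  exact this.exists

/-! ### Assembling the transformer -/

/-- The coordinates that receive the output of the given transformer. -/
def modelCoord : Slot k N → Module.Dual ℝ (Fin N → ℝ)
  | .inr (.inr (.model, i)) => LinearMap.proj i
  | _ => 0

/-- The old output perceptron writes into the `model` register, and the old coordinates are cleared,
so the widths of the tail need not depend on `m` or `W`. -/
theorem exists_model_mlp {m m' : ℕ} (e : Fin m ⊕ Slot k N ≃ Fin m') (M : MLP m N) :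
    ∃ M' : MLP m' m', M'.width ≤ M.width + 2 * Fintype.card (Slot k N) ∧ M'.depth = M.depth ∧
      ∀ (T : ℕ) (X : Matrix (Fin T) (Fin m) ℝ) (Y : Fin T → Slot k N → ℝ) (p : Fin T),
        M'.eval (encode e (sideBySide X Y) p) =
          encode e (sideBySide 0 fun p => Y p + LinearMap.pi modelCoord (M.eval (X p))) p := by
  obtain ⟨M', hw, hd, hM'⟩ := M.exists_parallel e e (LinearMap.funLeft ℝ ℝ Sum.inl)
    (LinearMap.pi (Sum.elim 0 modelCoord))
    (LinearMap.funLeft ℝ ℝ Sum.inr) (LinearMap.pi (Sum.elim 0 LinearMap.proj))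
  refine ⟨M', hw, hd, fun T X Y p => (hM' (sideBySide X Y p)).trans ?_⟩
  have h1 : LinearMap.funLeft ℝ ℝ Sum.inl (sideBySide X Y p) = X p := rfl
  have h2 : LinearMap.funLeft ℝ ℝ Sum.inr (sideBySide X Y p) = Y p := rfl
  ext j
  simp only [Function.comp, encode, h1, h2]
  rcases e.symm j with i | i
  · simp [sideBySide]
  · simp [sideBySide, add_comm]

theorem tokenSlots_add_model (τ : ℕ → ℝ) (p : ℕ) (o : Option (Fin N)) (ν μ : Fin N → ℝ) :
    tokenSlots (k := k) τ p o ν 0 + LinearMap.pi modelCoord μ = tokenSlots τ p o ν μ := by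
  ext j
  rcases j with (_ | _ | _) | (⟨_ | _, _⟩ | ⟨_ | _, _⟩) <;> simp [tokenSlots, modelCoord]

/-- The embedding of a transformer next to the additional coordinates. -/
theorem exists_embedding {m m' : ℕ} (e : Fin m ⊕ Slot k N ≃ Fin m') (τ : ℕ → ℝ)
    (g : Transformer T N m) :
    ∃ (bos : Fin m' → ℝ) (embed : Fin N → Fin T → Fin m' → ℝ),
      ∀ (bs : List (Attention m' × MLP m' m')) (f : Attention m') (M : MLP m' N)
        (θ : Fin T → Fin N), (Transformer.mk bos embed bs f M).input θ =
          encode e (sideBySide (g.input θ) fun p => tokenSlots τ p (heldState θ p) 0 0) := by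
  refine ⟨fun j => Sum.elim g.bos (tokenSlots τ 0 none 0 0) (e.symm j),
    fun i p j => Sum.elim (g.embed i p) (tokenSlots τ p (some i) 0 0) (e.symm j),
    fun bs f M θ => ?_⟩
  ext p j
  by_cases hp : (p : ℕ) = 0
  · simp [Transformer.input, encode, sideBySide, heldState, hp]
  · simp [Transformer.input, encode, sideBySide, heldState, hp]

/-- A transformer extended by the additional coordinates and the final layers. -/
theorem exists_switching_transformer (hN : 0 < N) (U : Fin k → Fin N → ℝ) (τ : ℕ → ℝ) (ε l κ : ℝ)
    {m H W B : ℕ} (g : Transformer T N m)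
    (hb : ∀ b ∈ g.blocks, b.1.heads ≤ H ∧ b.2.width ≤ W ∧ b.2.depth ≤ B)
    (hH : g.last.heads ≤ H) (hW : g.out.width ≤ W) (hB : g.out.depth ≤ B) :
    ∃ g' : Transformer T N (m + Fintype.card (Slot k N)),
      g'.depth = g.depth + 4 ∧
      (∀ b ∈ g'.blocks.take g.depth, b.1.heads ≤ H + 1 ∧
        b.2.width ≤ W + 2 * Fintype.card (Slot k N) ∧ b.2.depth ≤ B) ∧
      (∀ b ∈ g'.blocks.drop g.depth, b.1.heads ≤ 3 ∧
        b.2.width ≤ 2 * N + 1 + 2 * Fintype.card (Slot k N) ∧ b.2.depth ≤ 1) ∧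
      g'.last.heads ≤ 3 ∧ g'.out.width ≤ 4 * N ∧ g'.out.depth = 1 ∧
      ∀ (θ : Fin T → Fin N) (t : Fin T), g'.eval θ t = readout T
        (collected U τ θ (fun b => if b then polya θ else g.eval θ) ε l κ t) := by
  let e : Fin m ⊕ Slot k N ≃ Fin (m + Fintype.card (Slot k N)) :=
    Fintype.equivFinOfCardEq (by simp)
  obtain ⟨bs, hlen, hbs, hfold⟩ := exists_extend_blocks e g.blocks hb
  -- The urn head shares the last attention layer of `g`, so it costs no additional depth.
  obtain ⟨f, hf, hfl⟩ := exists_extend_attention e finOneEquiv.symm g.last (fun _ => ())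
    polyaQ polyaK polyaV
  obtain ⟨M, hMw, hMd, hM⟩ := exists_model_mlp e g.out
  obtain ⟨tl, fl, Ml, htl, htb, hfh, hw, hd, hev⟩ := exists_tail U τ T e ε l κ
  obtain ⟨bos, embed, hin⟩ := exists_embedding e τ g
  have hlen' : (bs ++ [(f, M)]).length = g.depth := by simp [Transformer.depth, hlen]
  refine ⟨⟨bos, embed, (bs ++ [(f, M)]) ++ tl, fl, Ml⟩, ?_, ?_, ?_, hfh, hw, hd, fun θ t => ?_⟩
  · simp only [Transformer.depth, List.length_append, hlen, htl, List.length_singleton]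
  · intro b hb'
    rw [List.take_left' hlen', List.mem_append, List.mem_singleton] at hb'
    rcases hb' with hb' | rfl
    · exact hbs b hb'
    · exact ⟨by simp only; omega, by simp only; omega, by simp only; omega⟩
  · intro b hb'
    rw [List.drop_left' hlen'] at hb'
    exact htb b hb'
  · rw [Transformer.eval_eq, hin, List.foldl_append, List.foldl_append, hfold, List.foldl_cons,
      List.foldl_nil, ← hev]
    have hstep : blockStep (encode e (sideBySide (g.blocks.foldl blockStep (g.input θ))
        fun p : Fin T => tokenSlots τ p (heldState θ p) 0 0)) (f, M) =
        encode e (sideBySide 0 (tokens τ θ fun b => if b then polya θ else g.eval θ)) := by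
      ext p j
      rw [blockStep, hfl, hM, attn_polya hN]
      simp only [tokenSlots_add_model]
      rfl
    rw [hstep]

end RobustLM

end

/-! ### Choice of parameters and the size bounds. -/

open RobustLM
theorem mainTheorem4 :
    ∃ C : ℕ, ∀ (k N T : ℕ), 0 < k → 0 < N → 0 < T →
      ∀ (D₀ : PMF (Fin T → Fin N)), (∀ x, D₀ x ≠ 0) →
      ∀ (U : Fin k → Fin N → ℝ), (∀ a i, |U a i| ≤ 1) →
      ∀ (m H W B : ℕ) (g : Transformer T N m),
        (∀ b ∈ g.blocks, b.1.heads ≤ H ∧ b.2.width ≤ W ∧ b.2.depth ≤ B) →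
        g.last.heads ≤ H → g.out.width ≤ W → g.out.depth ≤ B →
        (∀ θ t i, g.eval θ t i = nextTokenProb D₀ θ t i) →
      ∀ (α c : ℝ), 0 < α → 0 < c →
        ∃ (m' : ℕ) (g' : Transformer T N m') (δ : ℝ),
          g'.depth = g.depth + 4 ∧
          m' ≤ m + C * (k ^ 3 + N) ∧
          (∀ b ∈ g'.blocks.take g.depth,
            b.1.heads ≤ H + C * k ^ 2 ∧
            b.2.width ≤ W + C * (k ^ 3 + N) * (1 + Nat.log 2 T) ∧
            b.2.depth ≤ B + C) ∧
          (∀ b ∈ g'.blocks.drop g.depth,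
            b.1.heads ≤ C * k ^ 2 ∧
            b.2.width ≤ C * (k ^ 3 + N) * (1 + Nat.log 2 T) ∧
            b.2.depth ≤ C) ∧
          g'.last.heads ≤ C * k ^ 2 ∧
          g'.out.width ≤ C * (k ^ 3 + N) * (1 + Nat.log 2 T) ∧
          g'.out.depth ≤ C ∧
          0 ≤ δ ∧ δ ≤ 1 / (T : ℝ) ^ c ∧
          ∀ (θ : Fin T → Fin N) (t : Fin T),
            ((∃ s : ℕ, 1 ≤ s ∧ s + k ≤ (t : ℕ) + 1 ∧
                regretHedge U θ s + margin T k α s + δ ≤ regret U D₀ θ s) →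
              g'.eval θ t = polya θ t) ∧
            ((∀ s : ℕ, 1 ≤ s → s + k ≤ (t : ℕ) + 1 →
                regret U D₀ θ s < regretHedge U θ s + margin T k α s - δ) →
              g'.eval θ t = nextTokenProb D₀ θ t) := by
  -- The largest cost is the tail width `2N + 1 + 2 (11 + 5k + 4N)`; since `k, N ≥ 1` and `k ≤ k ^
  -- 3`, the constant `40` is ample.
  refine ⟨40, fun k N T hk hN hT D₀ _ U hU m H W B g hb hH hW hB hg α c _ hc => ?_⟩
  have hT1 : (1 : ℝ) ≤ T := by exact_mod_cast hT
  have hTc : 1 ≤ (T : ℝ) ^ c := Real.one_le_rpow hT1 hc.le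
  set δ : ℝ := 1 / (T : ℝ) ^ c with hδ
  have hδ0 : 0 < δ := by positivity
  have hδ1 : δ ≤ 1 := (div_le_one (by positivity)).2 hTc
  obtain ⟨l, hl⟩ := exists_sharpness hk U hU (threshold T k α) D₀ (1 / Real.sqrt T)
    (e := δ / (2 * T)) (by positivity)
  obtain ⟨g', h1, h2, h3, h4, h5, h6, h7⟩ := exists_switching_transformer hN U (threshold T k α)
    (1 / Real.sqrt T) l (2 * T / δ) g hb hH hW hB
  have hg' : ∀ θ, g.eval θ = nextTokenProb D₀ θ := fun θ => funext₂ (hg θ)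
  have hk3 : k ≤ k ^ 3 := Nat.le_self_pow (by norm_num) k
  have hk2 : 1 ≤ k ^ 2 := Nat.one_le_pow _ _ hk
  have hcard := card_slot k N
  have hlog : 40 * (k ^ 3 + N) ≤ 40 * (k ^ 3 + N) * (1 + Nat.log 2 T) :=
    Nat.le_mul_of_pos_right _ (by omega)
  refine ⟨_, g', δ, h1, by omega, fun b hb' => ?_, fun b hb' => ?_, by omega, by omega, by omega,
    hδ0.le, le_rfl, fun θ t => ?_⟩
  · obtain ⟨p1, p2, p3⟩ := h2 b hb'
    exact ⟨by omega, by omega, by omega⟩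
  · obtain ⟨p1, p2, p3⟩ := h3 b hb'
    exact ⟨by omega, by omega, by omega⟩
  · have := readout_collected hk U D₀ θ hδ0 hδ1 (hl θ) t
    rw [h7, hg']
    exact this
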